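/- Let $k$ be a field, $n\ge 1$, let $Q=(q_1,\dots,q_n)\in(k^\times)^n$ with no $q_i$ a root of unity, and let $\Gamma=(\gamma_{ij})$ be a multiplicatively antisymmetric $n\times n$ matrix over $k$ (that is, $\gamma_{ii}=1$ and $\gamma_{ij}\gamma_{ji}=1$ for all $i,j$). Let $Y_n=Y_n^{Q,\Gamma}(k)$ be the multiparameter quantized Weyl algebra, i.e. the unital associative $k$-algebra with generators $x_1,\dots,x_n,y_1,\dots,y_n$ and relations \begin{align*} y_iy_j&=\gamma_{ij}y_jy_i&&\text{for all } i,j,\\ x_iy_j&=\gamma_{ji}y_jx_i&&(i<j),\\ x_iy_j&=q_j\gamma_{ji}y_jx_i&&(i>j),\\ x_ix_j&=q_i\gamma_{ij}x_jx_i&&(i<j),\\ x_iy_i&=q_iy_ix_i+1+\sum_{l<i}(q_l-1)y_lx_l&&\text{for all } i. \end{align*} Let the torus $H=(k^\times)^n$ act on $Y_n$ by algebra automorphisms via $t\cdot x_i=t_ix_i$ and $t\cdot y_i=t_i^{-1}y_i$, and let $\operatorname{Spec}_H Y_n$ be the set of $H$-stable prime (two-sided) ideals of $Y_n$, ordered by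 inclusion. Let $W$ be the Coxeter group of type $A_n$ with standard generators $s_1,\dots,s_n$ (so $s_i^2=1$, $(s_is_{i+1})^3=1$, and $(s_is_j)^2=1$ if $|i-j|\ge 2$), and let $w_n=s_ns_{n-1}\cdots s_2s_1s_2\cdots s_n$. Then the partially ordered set $\operatorname{Spec}_H Y_n$ is isomorphic to the interval $[1,w_n]=\{w\in W: w\le w_n\}$ in the Bruhat order of $W$. -/

import Mathlib

/-! ### Multiparameter quantized Weyl algebras -/

/-- Names of the generators `x₁, …, xₙ, y₁, …, yₙ`; the index `i : Fin n` stands for `i + 1`. -/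
inductive QWeylGen (n : ℕ) : Type
  | x (i : Fin n) : QWeylGen n
  | y (i : Fin n) : QWeylGen n

namespace QWeylGen

/-- The generator `xᵢ` of the free algebra. -/
def freeX (k : Type*) [Field k] {n : ℕ} (i : Fin n) : FreeAlgebra k (QWeylGen n) :=
  FreeAlgebra.ι k (QWeylGen.x i)

/-- The generator `yᵢ` of the free algebra. -/
def freeY (k : Type*) [Field k] {n : ℕ} (i : Fin n) : FreeAlgebra k (QWeylGen n) :=
  FreeAlgebra.ι k (QWeylGen.y i)

end QWeylGen

open QWeylGen in
/-- The defining relations of the multiparameter quantized Weyl algebra. -/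
inductive QWeylRel {k : Type*} [Field k] {n : ℕ} (Q : Fin n → kˣ) (Γ : Matrix (Fin n) (Fin n) k) :
    FreeAlgebra k (QWeylGen n) → FreeAlgebra k (QWeylGen n) → Prop
  | yy (i j : Fin n) :
      QWeylRel Q Γ (freeY k i * freeY k j) (Γ i j • (freeY k j * freeY k i))
  | xy_lt (i j : Fin n) (h : i < j) :
      QWeylRel Q Γ (freeX k i * freeY k j) (Γ j i • (freeY k j * freeX k i))
  | xy_gt (i j : Fin n) (h : j < i) :
      QWeylRel Q Γ (freeX k i * freeY k j) (((Q j : k) * Γ j i) • (freeY k j * freeX k i))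
  | xx (i j : Fin n) (h : i < j) :
      QWeylRel Q Γ (freeX k i * freeX k j) (((Q i : k) * Γ i j) • (freeX k j * freeX k i))
  | xy_eq (i : Fin n) :
      QWeylRel Q Γ (freeX k i * freeY k i)
        ((Q i : k) • (freeY k i * freeX k i) + 1 +
          ∑ l ∈ Finset.Iio i, ((Q l : k) - 1) • (freeY k l * freeX k l))

/-- The multiparameter quantized Weyl algebra `Yₙ = Yₙ^{Q,Γ}(k)`. -/
abbrev QWeyl {k : Type*} [Field k] {n : ℕ} (Q : Fin n → kˣ) (Γ : Matrix (Fin n) (Fin n) k) : Type _ :=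
  RingQuot (QWeylRel Q Γ)

namespace QWeyl

section

variable {k : Type*} [Field k] {n : ℕ} (Q : Fin n → kˣ) (Γ : Matrix (Fin n) (Fin n) k)

/-- The generator `xᵢ` of `Yₙ`. -/
def X (i : Fin n) : QWeyl Q Γ := RingQuot.mkAlgHom k (QWeylRel Q Γ) (QWeylGen.freeX k i)

/-- The generator `yᵢ` of `Yₙ`. -/
def Y (i : Fin n) : QWeyl Q Γ := RingQuot.mkAlgHom k (QWeylRel Q Γ) (QWeylGen.freeY k i)

/-- The images of the generators under a torus element `t = (t₁, …, tₙ)`: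
`xᵢ ↦ tᵢ xᵢ` and `yᵢ ↦ tᵢ⁻¹ yᵢ`. -/
def torusGen (t : Fin n → kˣ) : QWeylGen n → QWeyl Q Γ
  | .x i => (t i : k) • X Q Γ i
  | .y i => ((t i)⁻¹ : kˣ).val • Y Q Γ i

theorem torusGen_rel (t : Fin n → kˣ) ⦃a b : FreeAlgebra k (QWeylGen n)⦄ (h : QWeylRel Q Γ a b) :
    FreeAlgebra.lift k (torusGen Q Γ t) a = FreeAlgebra.lift k (torusGen Q Γ t) b := by
  have key := RingQuot.mkAlgHom_rel k h
  cases h with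
  | xy_eq i =>
    simp only [map_mul, map_smul, map_add, map_one, map_sum] at key
    simp only [QWeylGen.freeX, QWeylGen.freeY, map_mul, map_smul, map_add, map_one, map_sum,
      FreeAlgebra.lift_ι_apply, torusGen, smul_mul_smul_comm, Units.inv_mul, Units.mul_inv,
      one_smul]
    exact key
  | _ =>
    simp only [map_mul, map_smul] at key
    simp only [QWeylGen.freeX, QWeylGen.freeY, map_mul, map_smul, FreeAlgebra.lift_ι_apply,
      torusGen, smul_mul_smul_comm]
    simp only [X, Y]
    rw [key, smul_smul, smul_smul]
    congr 1
    ring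

/-- The endomorphism of `Yₙ` given by a torus element. -/
def torusHom (t : Fin n → kˣ) : QWeyl Q Γ →ₐ[k] QWeyl Q Γ :=
  RingQuot.liftAlgHom k ⟨FreeAlgebra.lift k (torusGen Q Γ t), torusGen_rel Q Γ t⟩

@[simp] theorem torusHom_X (t : Fin n → kˣ) (i : Fin n) :
    torusHom Q Γ t (X Q Γ i) = (t i : k) • X Q Γ i := by
  simp [torusHom, X, QWeylGen.freeX, torusGen]

@[simp] theorem torusHom_Y (t : Fin n → kˣ) (i : Fin n) :
    torusHom Q Γ t (Y Q Γ i) = ((t i)⁻¹ : kˣ).val • Y Q Γ i := by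
  simp [torusHom, Y, QWeylGen.freeY, torusGen]

theorem algHom_ext {f g : QWeyl Q Γ →ₐ[k] QWeyl Q Γ}
    (hX : ∀ i, f (X Q Γ i) = g (X Q Γ i)) (hY : ∀ i, f (Y Q Γ i) = g (Y Q Γ i)) : f = g := by
  apply RingQuot.ringQuot_ext'
  apply FreeAlgebra.hom_ext
  funext a
  cases a with
  | x i => exact hX i
  | y i => exact hY i

theorem torusHom_one : torusHom Q Γ 1 = AlgHom.id k _ :=
  algHom_ext Q Γ (fun i => by simp) (fun i => by simp)

theorem torusHom_mul (s t : Fin n → kˣ) :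
    torusHom Q Γ (s * t) = (torusHom Q Γ s).comp (torusHom Q Γ t) :=
  algHom_ext Q Γ (fun i => by simp [smul_smul, mul_comm]) (fun i => by simp [smul_smul, mul_comm])

/-- The action of the torus `H = (kˣ)ⁿ` on `Yₙ` by algebra automorphisms,
`t · xᵢ = tᵢ xᵢ` and `t · yᵢ = tᵢ⁻¹ yᵢ`. -/
def torusAction : (Fin n → kˣ) →* (QWeyl Q Γ ≃ₐ[k] QWeyl Q Γ) where
  toFun t := AlgEquiv.ofAlgHom (torusHom Q Γ t) (torusHom Q Γ t⁻¹)
    (by rw [← torusHom_mul, mul_inv_cancel, torusHom_one])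
    (by rw [← torusHom_mul, inv_mul_cancel, torusHom_one])
  map_one' := by
    ext a
    exact DFunLike.congr_fun (torusHom_one Q Γ) a
  map_mul' s t := by
    ext a
    exact DFunLike.congr_fun (torusHom_mul Q Γ s t) a

end

end QWeyl

/-! ### Torus-invariant primes -/

/-- Prime (two-sided) ideals of a noncommutative ring: `P` is proper, and `I J ⊆ P` implies
`I ⊆ P` or `J ⊆ P` for all two-sided ideals `I` and `J`. -/
def TwoSidedIdeal.IsPrimeIdeal {R : Type*} [Ring R] (P : TwoSidedIdeal R) : Prop :=
  P ≠ ⊤ ∧ ∀ I J : TwoSidedIdeal R, (∀ a ∈ I, ∀ b ∈ J, a * b ∈ P) → I ≤ P ∨ J ≤ P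

/-- The torus-invariant prime spectrum `Spec_H Yₙ`, ordered by inclusion. -/
abbrev QWeyl.HSpec {k : Type*} [Field k] {n : ℕ} (Q : Fin n → kˣ) (Γ : Matrix (Fin n) (Fin n) k) :
    Type _ :=
  {P : TwoSidedIdeal (QWeyl Q Γ) //
    P.IsPrimeIdeal ∧ ∀ t : Fin n → kˣ, ∀ a ∈ P, QWeyl.torusAction Q Γ t a ∈ P}

/-! ### Bruhat order -/

namespace CoxeterSystem

section

variable {B W : Type*} [Group W] {M : CoxeterMatrix B} (cs : CoxeterSystem M W)

/-- The Bruhat order: the reflexive and transitive closure of the relation `u < u t`, for `t` a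
reflection with `ℓ(u) < ℓ(u t)`. -/
def BruhatLE : W → W → Prop :=
  Relation.ReflTransGen fun u v => ∃ t, cs.IsReflection t ∧ v = u * t ∧ cs.length u < cs.length v

theorem BruhatLE.eq_or_length_lt {u v : W} (h : cs.BruhatLE u v) :
    u = v ∨ cs.length u < cs.length v := by
  induction h with
  | refl => exact Or.inl rfl
  | tail _ hbc ih =>
    obtain ⟨t, -, -, hlt⟩ := hbc
    rcases ih with rfl | ih
    · exact Or.inr hlt
    · exact Or.inr (ih.trans hlt)

/-- The interval `[1, w]` in the Bruhat order, that is, the set of all `u ≤ w`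
(the identity is the least element of the Bruhat order). -/
def BruhatInterval (w : W) : Type _ := {u : W // cs.BruhatLE u w}

instance (w : W) : PartialOrder (cs.BruhatInterval w) where
  le u v := cs.BruhatLE u.1 v.1
  le_refl _ := Relation.ReflTransGen.refl
  le_trans _ _ _ h₁ h₂ := Relation.ReflTransGen.trans h₁ h₂
  le_antisymm u v h₁ h₂ := by
    rcases BruhatLE.eq_or_length_lt cs h₁ with h | h
    · exact Subtype.ext h
    · rcases BruhatLE.eq_or_length_lt cs h₂ with h' | h'
      · exact Subtype.ext h'.symm
      · exact absurd h (lt_asymm h')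

end

end CoxeterSystem

/-- The word `sₙ ⋯ s₂ s₁ s₂ ⋯ sₙ`; the index `i : Fin n` stands for `sᵢ₊₁`. -/
def palindromeWord (n : ℕ) : List (Fin n) :=
  (List.finRange n).reverse ++ (List.finRange n).tail

/-! Both posets are identified with one combinatorial poset, `AdmissibleSet n`. With indices from 0,
put `z_m = 1 + ∑_{l<m} (q_l - 1) y_l x_l`. Each `z_m` commutes with every generator up to a nonzero
scalar, `z_0 = 1`, and `(q_i - 1) y_i x_i` and `(q_i - 1) x_i y_i` are combinations of `z_i` and
`z_{i+1}`. Hence a prime contains `x_i` or `y_i` exactly when it contains both `z_i` and `z_{i+1}`,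
and the `z`, `x`, `y` that it contains form an admissible set.

A torus-stable prime P is recovered from this set. Modulo any ideal containing the indexed elements,
the algebra is spanned by the monomials in the remaining ones that never mix `x_i` with `y_i`
(`mem_span_allowedMon_sup`). These are independent modulo P: torus weights separate their degrees
(`mem_of_sum_mem`), commutation with generators separates the `z`-parts within a degree
(`coeff_eq_zero`), and no single one lies in P (`zmon_mul_mon_notMem`). All three steps use that no
`q_i` is a root of unity. So inclusion of admissible sets forces inclusion of primes
(`le_of_contains`). Conversely, every admissible set is realised by the kernel of a map to a quantum
torus, which has no zero divisors (`toAdmissible_repKer`).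

On the Coxeter side an admissible set encodes a subword of the palindrome. That `z (m+1)` holds
means that letter `m` survives in the product of the letters up to `m`. If `z m` holds, `x m` and `y
m` record the left and right copies of `m`. If it fails, letter `m` commutes with the inner product:
two copies cancel and the side of a single one is irrelevant. Thus every subword product is some
`toCoxeter T` (`toCoxeter_ofMask`), and T is determined by it (`toCoxeter_injective`). Strong
exchange shows that all elements Bruhat-below `toCoxeter T` come from smaller sets; the converse
follows by deleting one letter at a time (`bruhatLE_of_le`). -/

namespace CoxeterSystem

/-! ### Strong exchange and subwords -/

variable {B W : Type*} [Group W] {M : CoxeterMatrix B} (cs : CoxeterSystem M W)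

open Classical in
/-- The action of a simple reflection on pairs (group element, parity): conjugation, with a
change of parity exactly at the simple reflection itself. -/
noncomputable def parityPerm (i : B) : Equiv.Perm (W × ZMod 2) :=
  Function.Involutive.toPerm
    (fun p => (cs.simple i * p.1 * cs.simple i, p.2 + if p.1 = cs.simple i then 1 else 0)) <| by
    rintro ⟨t, e⟩
    have h : cs.simple i * t * cs.simple i = cs.simple i ↔ t = cs.simple i := by
      constructor
      · intro h
        have := congrArg (fun a => cs.simple i * a * cs.simple i) h
        simpa [mul_assoc] using this
      · rintro rfl
        simp
    ext
    · simp [mul_assoc]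
    · simp only [h]
      split_ifs
      · rw [add_assoc, CharTwo.add_self_eq_zero, add_zero]
      · simp

open Classical in
theorem parityPerm_apply (i : B) (t : W) (e : ZMod 2) :
    cs.parityPerm i (t, e) =
      (cs.simple i * t * cs.simple i, e + if t = cs.simple i then 1 else 0) := rfl

theorem simple_mul_pow_mul_simple (i j : B) (m : ℕ) :
    cs.simple j * (cs.simple i * cs.simple j) ^ m =
      ((cs.simple i * cs.simple j) ^ m)⁻¹ * cs.simple j := by
  rw [← inv_pow]
  refine SemiconjBy.pow_right ?_ m
  simp [SemiconjBy, mul_assoc]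

-- The elements `s_j (s_i s_j)^k` are those that are carried to the next simple reflection at step
-- `k` of the alternating word; each such hit flips the parity.
open Classical in
theorem parityPerm_mul_pow_apply (i j : B) (m : ℕ) (t : W) (e : ZMod 2) :
    ((cs.parityPerm i * cs.parityPerm j) ^ m) (t, e) =
      ((cs.simple i * cs.simple j) ^ m * t * ((cs.simple i * cs.simple j) ^ m)⁻¹,
        e + ∑ k ∈ Finset.range (2 * m),
          if t = cs.simple j * (cs.simple i * cs.simple j) ^ k then 1 else 0) := by
  induction m with
  | zero => simp
  | succ m ih =>
    rw [pow_succ', Equiv.Perm.mul_apply, ih, Equiv.Perm.mul_apply, parityPerm_apply,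
      parityPerm_apply, show 2 * (m + 1) = 2 * m + 1 + 1 by ring, Finset.sum_range_succ,
      Finset.sum_range_succ]
    set c := cs.simple i * cs.simple j with hc
    have h1 : c ^ m * t * (c ^ m)⁻¹ = cs.simple j ↔ t = cs.simple j * c ^ (2 * m) := by
      rw [two_mul, pow_add, ← mul_assoc, hc, cs.simple_mul_pow_mul_simple, ← hc,
        mul_inv_eq_iff_eq_mul, mul_assoc, eq_inv_mul_iff_mul_eq]
    have h2 : cs.simple j * (c ^ m * t * (c ^ m)⁻¹) * cs.simple j = cs.simple i ↔
        t = cs.simple j * c ^ (2 * m + 1) := by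
      have h3 : cs.simple j * c ^ (2 * m + 1) = (c ^ m)⁻¹ * (cs.simple j * c) * c ^ m := by
        rw [show 2 * m + 1 = m + (1 + m) by ring, pow_add, ← mul_assoc, hc,
          cs.simple_mul_pow_mul_simple, pow_add, pow_one]
        simp only [mul_assoc]
      rw [h3, ← eq_mul_inv_iff_mul_eq, ← eq_inv_mul_iff_mul_eq, mul_inv_eq_iff_eq_mul,
        mul_assoc ((c ^ m)⁻¹), eq_inv_mul_iff_mul_eq, hc]
      simp only [inv_simple, mul_assoc]
    ext
    · simp [pow_succ', hc, mul_assoc]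
    · simp only [h1, h2, add_assoc]

/-- Since `(s_i s_j)^(M i j) = 1`, the summands for `k` and `k + M i j` coincide and the total
parity change is even. -/
theorem isLiftable_parityPerm : M.IsLiftable cs.parityPerm := by
  classical
  intro i j
  ext1 ⟨t, e⟩
  rw [parityPerm_mul_pow_apply, two_mul, Finset.sum_range_add]
  simp [pow_add, CharTwo.add_self_eq_zero]

/-- The action of `W` on pairs (group element, parity) generated by `parityPerm`. -/
noncomputable def parityHom : W →* Equiv.Perm (W × ZMod 2) :=
  cs.lift ⟨cs.parityPerm, cs.isLiftable_parityPerm⟩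

theorem parityHom_simple (i : B) : cs.parityHom (cs.simple i) = cs.parityPerm i :=
  cs.lift_apply_simple cs.isLiftable_parityPerm i

-- Consequently the parity of the number of occurrences of `t` in the right inversion sequence
-- depends only on the product of the word.
open Classical in
theorem parityHom_wordProd (ω : List B) (t : W) (e : ZMod 2) :
    cs.parityHom (cs.wordProd ω) (t, e) =
      (cs.wordProd ω * t * (cs.wordProd ω)⁻¹, e + ((cs.rightInvSeq ω).count t : ZMod 2)) := by
  induction ω with
  | nil => simp
  | cons i ω ih =>
    rw [wordProd_cons, map_mul, Equiv.Perm.mul_apply, ih, parityHom_simple, parityPerm_apply,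
      rightInvSeq, List.count_cons]
    have h : cs.wordProd ω * t * (cs.wordProd ω)⁻¹ = cs.simple i ↔
        (cs.wordProd ω)⁻¹ * cs.simple i * cs.wordProd ω = t := by
      rw [mul_inv_eq_iff_eq_mul, mul_assoc, inv_mul_eq_iff_eq_mul, eq_comm]
    ext
    · simp [mul_assoc]
    · simp only [h, beq_iff_eq, add_assoc]
      split_ifs <;> simp

theorem parityHom_add (w t : W) (e a : ZMod 2) :
    cs.parityHom w (t, e + a) =
      ((cs.parityHom w (t, e)).1, (cs.parityHom w (t, e)).2 + a) := by
  obtain ⟨ω, rfl⟩ := cs.wordProd_surjective w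
  simp only [parityHom_wordProd]
  ext <;> simp [add_right_comm]

/-- Along `w s_i w⁻¹` the parity changes due to `w⁻¹` and `w` cancel, leaving the single flip of
`s_i` at itself. -/
theorem IsReflection.parityHom_self {t : W} (ht : cs.IsReflection t) :
    cs.parityHom t (t, 0) = (t, 1) := by
  classical
  obtain ⟨w, i, rfl⟩ := ht
  set p := (cs.parityHom w)⁻¹ (w * cs.simple i * w⁻¹, 0) with hp
  have h1 : cs.parityHom w p = (w * cs.simple i * w⁻¹, 0) := by simp [hp]
  have h2 : p.1 = cs.simple i := by
    rw [hp, ← map_inv]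
    obtain ⟨ω, hω⟩ := cs.wordProd_surjective w⁻¹
    rw [← hω, parityHom_wordProd, hω]
    simp [mul_assoc]
  obtain ⟨a, e⟩ := p
  simp only at h2
  subst h2
  rw [map_mul, map_mul, Equiv.Perm.mul_apply, Equiv.Perm.mul_apply, map_inv, ← hp,
    parityHom_simple, parityPerm_apply]
  simp only [simple_mul_simple_self, one_mul, if_true]
  rw [parityHom_add, h1]
  simp

/-- The strong exchange property. -/
theorem exists_eraseIdx_of_length_mul_lt {ω : List B} {t : W} (ht : cs.IsReflection t)
    (h : cs.length (cs.wordProd ω * t) < cs.length (cs.wordProd ω)) :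
    ∃ j, cs.wordProd ω * t = cs.wordProd (ω.eraseIdx j) := by
  classical
  by_cases hmem : t ∈ cs.rightInvSeq ω
  · obtain ⟨j, hj, hjt⟩ := List.getElem_of_mem hmem
    refine ⟨j, ?_⟩
    rw [← wordProd_mul_getD_rightInvSeq, List.getD_eq_getElem _ _ hj, hjt]
  -- With `w` the product of `ω`: if `t` never occurs for `w`, then `w t` sends `(t, 0)` to parity
  -- 1, so `t` is a right inversion of `w t`, against the assumed drop in length.
  · exfalso
    obtain ⟨ω', hω', hw⟩ := cs.exists_isReduced (cs.wordProd ω * t)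
    have h1 := cs.parityHom_wordProd ω' t 0
    rw [← hw, map_mul, Equiv.Perm.mul_apply, ht.parityHom_self, parityHom_wordProd,
      List.count_eq_zero_of_not_mem hmem] at h1
    have h2 : t ∈ cs.rightInvSeq ω' := by
      by_contra hn
      rw [List.count_eq_zero_of_not_mem hn] at h1
      simpa using congrArg Prod.snd h1
    have h3 := (cs.isRightInversion_of_mem_rightInvSeq hω' h2).2
    rw [← hw, mul_assoc, ht.mul_self, mul_one] at h3
    exact lt_asymm h h3

/-- Strong exchange needs no reduced word, so it can be iterated down a chain for an arbitrary word
of `v`. -/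
theorem BruhatLE.exists_sublist {u v : W} (h : cs.BruhatLE u v) :
    ∀ ω, v = cs.wordProd ω → ∃ ω', ω'.Sublist ω ∧ u = cs.wordProd ω' := by
  induction h with
  | refl => exact fun ω hω => ⟨ω, List.Sublist.refl _, hω⟩
  | @tail b c _ hbc ih =>
    obtain ⟨t, ht, rfl, hlt⟩ := hbc
    intro ω hω
    have hb : b = cs.wordProd ω * t := by rw [← hω, mul_assoc, ht.mul_self, mul_one]
    obtain ⟨j, hj⟩ := cs.exists_eraseIdx_of_length_mul_lt (ω := ω) ht
      (by rw [← hb, ← hω]; exact hlt)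
    obtain ⟨ω', h1, h2⟩ := ih _ (hb.trans hj)
    exact ⟨ω', h1.trans (List.eraseIdx_sublist ω j), h2⟩

theorem IsReflection.bruhatLE_or (u : W) {t : W} (ht : cs.IsReflection t) :
    cs.BruhatLE u (u * t) ∨ cs.BruhatLE (u * t) u := by
  rcases lt_or_gt_of_ne (ht.length_mul_left_ne u) with h | h
  · exact Or.inr (Relation.ReflTransGen.single
      ⟨t, ht, by rw [mul_assoc, ht.mul_self, mul_one], h⟩)
  · exact Or.inl (Relation.ReflTransGen.single ⟨t, ht, rfl, h⟩)

end CoxeterSystem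

/-! ### Admissible sets -/

/-- Admissible sets: combinatorial data recording which of the elements `z_0, …, z_n`, `x_i`, `y_i`
lie in a torus-invariant prime ideal. Here `x i`, `y i` are indexed from `0`. -/
@[ext]
structure AdmissibleSet (n : ℕ) where
  /-- the indices of the elements `z` -/
  z : ℕ → Prop
  /-- the indices of the elements `x` -/
  x : ℕ → Prop
  /-- the indices of the elements `y` -/
  y : ℕ → Prop
  not_z_zero : ¬ z 0
  x_or_y_iff : ∀ i, x i ∨ y i ↔ z i ∧ z (i + 1)
  le_of_z : ∀ i, z i → i ≤ n

namespace AdmissibleSet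

variable {n : ℕ}

instance : PartialOrder (AdmissibleSet n) :=
  PartialOrder.lift (fun T => (T.z, T.x, T.y)) fun S T h => by
    simp only [Prod.mk.injEq] at h
    exact AdmissibleSet.ext h.1 h.2.1 h.2.2

theorem le_def {S T : AdmissibleSet n} :
    S ≤ T ↔ (∀ i, S.z i → T.z i) ∧ (∀ i, S.x i → T.x i) ∧ ∀ i, S.y i → T.y i := Iff.rfl

theorem z_of_x (T : AdmissibleSet n) {i : ℕ} (h : T.x i) : T.z i ∧ T.z (i + 1) :=
  (T.x_or_y_iff i).1 (Or.inl h)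

theorem z_of_y (T : AdmissibleSet n) {i : ℕ} (h : T.y i) : T.z i ∧ T.z (i + 1) :=
  (T.x_or_y_iff i).1 (Or.inr h)

theorem lt_of_z_succ (T : AdmissibleSet n) {i : ℕ} (h : T.z (i + 1)) : i < n := T.le_of_z _ h

/-- Finiteness makes the strict order well-founded, which the induction in `bruhatLE_of_le` needs.
-/
instance : Finite (AdmissibleSet n) := by
  refine Finite.of_injective (fun T (i : Fin (n + 1)) => (T.z i, T.x i, T.y i)) fun S T h => ?_
  have h1 : ∀ i, i ≤ n → S.z i = T.z i ∧ S.x i = T.x i ∧ S.y i = T.y i := fun i hi => by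
    have := congrFun h ⟨i, by omega⟩
    simpa only [Prod.mk.injEq] using this
  have h2 : ∀ (U : AdmissibleSet n) i, ¬ i ≤ n → ¬ U.z i ∧ ¬ U.x i ∧ ¬ U.y i := fun U i hi =>
    ⟨fun h => hi (U.le_of_z _ h), fun h => hi (U.le_of_z _ (U.z_of_x h).1),
      fun h => hi (U.le_of_z _ (U.z_of_y h).1)⟩
  ext i
  all_goals
    by_cases hi : i ≤ n
    · have := h1 i hi
      simp only [this]
    · have := h2 S i hi
      have := h2 T i hi
      tauto

/-! ### Masks: subwords of the palindrome word -/

/-- The one-letter word `m`, empty when out of range. -/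
def letter (n m : ℕ) : List (Fin n) := if h : m < n then [⟨m, h⟩] else []

open Classical in
/-- The subword of `m ⋯ 1 0 0 1 ⋯ m` keeping the left letters in `L` and the right letters
in `R`. -/
noncomputable def maskWord (n : ℕ) (L R : ℕ → Prop) : ℕ → List (Fin n)
  | 0 => []
  | m + 1 => (if L m then letter n m else []) ++ maskWord n L R m ++
      (if R m then letter n m else [])

/-- Whether the letter `m - 1` survives in the product of `maskWord`. -/
def maskZ (L R : ℕ → Prop) : ℕ → Prop
  | 0 => False
  -- If letter `m - 1` survives, two copies of `m` cannot cancel across the inner product; otherwise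
  -- `m` commutes with it and they do.
  | m + 1 => (maskZ L R m ∧ (L m ∨ R m)) ∨ (¬ maskZ L R m ∧ (L m ∧ ¬ R m ∨ R m ∧ ¬ L m))

/-- The admissible set of a subword of the palindrome word. -/
def ofMask (n : ℕ) (L R : ℕ → Prop) : AdmissibleSet n where
  z m := m ≤ n ∧ maskZ L R m
  x m := m < n ∧ maskZ L R m ∧ L m
  y m := m < n ∧ maskZ L R m ∧ R m
  not_z_zero := by simp [maskZ]
  x_or_y_iff i := by
    simp only [maskZ, Order.add_one_le_iff]
    have : i < n → i ≤ n := le_of_lt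
    tauto
  le_of_z i h := h.1

/-- The left letters of the canonical subword of an admissible set. -/
def left (T : AdmissibleSet n) (m : ℕ) : Prop := T.x m ∨ (¬ T.z m ∧ T.z (m + 1))

theorem left_or_y (T : AdmissibleSet n) {m : ℕ} : T.left m ∨ T.y m ↔ T.z (m + 1) := by
  have := T.x_or_y_iff m
  unfold left
  tauto

theorem maskWord_congr {L R L' R' : ℕ → Prop} {m : ℕ} (hL : ∀ i < m, L i ↔ L' i)
    (hR : ∀ i < m, R i ↔ R' i) : maskWord n L R m = maskWord n L' R' m := by
  induction m with
  | zero => rfl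
  | succ m ih =>
    have h1 : L m = L' m := propext (hL m (Nat.lt_succ_self m))
    have h2 : R m = R' m := propext (hR m (Nat.lt_succ_self m))
    rw [maskWord, maskWord, h1, h2,
      ih (fun i hi => hL i (by omega)) (fun i hi => hR i (by omega))]

open Classical in
theorem exists_of_sublist_ite {p : Prop} {m : ℕ} {ω : List (Fin n)}
    (h : ω.Sublist (if p then letter n m else [])) :
    ∃ p' : Prop, (p' → p) ∧ ω = if p' then letter n m else [] := by
  by_cases hp : p
  · rw [if_pos hp] at h
    by_cases hm : m < n
    · rw [letter, dif_pos hm, List.sublist_singleton] at h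
      rcases h with h | h
      · exact ⟨False, by simp, by simp [h]⟩
      · exact ⟨True, fun _ => hp, by simp [h, letter, hm]⟩
    · rw [letter, dif_neg hm, List.sublist_nil] at h
      exact ⟨False, by simp, by simp [h]⟩
  · rw [if_neg hp, List.sublist_nil] at h
    exact ⟨False, by simp, by simp [h]⟩

theorem exists_mask_of_sublist {L R : ℕ → Prop} {m : ℕ} {ω : List (Fin n)}
    (h : ω.Sublist (maskWord n L R m)) :
    ∃ L' R' : ℕ → Prop, (∀ i, L' i → L i) ∧ (∀ i, R' i → R i) ∧ ω = maskWord n L' R' m := by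
  classical
  induction m generalizing ω with
  | zero =>
    rw [maskWord, List.sublist_nil] at h
    exact ⟨L, R, by simp, by simp, by simp [h, maskWord]⟩
  | succ m ih =>
    rw [maskWord, List.append_assoc, List.sublist_append_iff] at h
    obtain ⟨ω₁, ω₂, rfl, h1, h2⟩ := h
    rw [List.sublist_append_iff] at h2
    obtain ⟨ω₃, ω₄, rfl, h2, h3⟩ := h2
    obtain ⟨p, hp, rfl⟩ := exists_of_sublist_ite h1
    obtain ⟨r, hr, rfl⟩ := exists_of_sublist_ite h3
    obtain ⟨L', R', hL, hR, rfl⟩ := ih h2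
    refine ⟨Function.update L' m p, Function.update R' m r, ?_, ?_, ?_⟩
    · intro i
      rcases eq_or_ne i m with rfl | hi
      · simpa using hp
      · simpa [hi] using hL i
    · intro i
      rcases eq_or_ne i m with rfl | hi
      · simpa using hr
      · simpa [hi] using hR i
    · have h4 : maskWord n (Function.update L' m p) (Function.update R' m r) m =
          maskWord n L' R' m :=
        maskWord_congr (fun i hi => by rw [Function.update_of_ne hi.ne])
          (fun i hi => by rw [Function.update_of_ne hi.ne])
      rw [maskWord, Function.update_self, Function.update_self, List.append_assoc, h4]

theorem z_of_maskZ {T : AdmissibleSet n} {L R : ℕ → Prop} (hL : ∀ i, L i → T.left i)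
    (hR : ∀ i, R i → T.y i) {m : ℕ} (h : maskZ L R m) : T.z m := by
  cases m with
  | zero => exact h.elim
  | succ m =>
    have := T.left_or_y (m := m)
    have := hL m
    have := hR m
    simp only [maskZ] at h
    tauto

theorem ofMask_le {T : AdmissibleSet n} {L R : ℕ → Prop} (hL : ∀ i, L i → T.left i)
    (hR : ∀ i, R i → T.y i) : ofMask n L R ≤ T := by
  refine ⟨fun i h => z_of_maskZ hL hR h.2, fun i h => ?_, fun i h => hR i h.2.2⟩
  have h1 := z_of_maskZ hL hR h.2.1
  rcases hL i h.2.2 with h2 | h2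
  · exact h2
  · exact absurd h1 h2.1

/-- The hypothesis `hLR` excludes the only way a letter can be lost, two copies cancelling; survival
then propagates from each letter to the next. -/
theorem le_ofMask {T : AdmissibleSet n} {L R : ℕ → Prop} (hL : ∀ i, T.x i → L i)
    (hR : ∀ i, T.y i → R i) (hz : ∀ i, T.z (i + 1) → L i ∨ R i)
    (hLR : ∀ i, L i → R i → T.z i ∨ maskZ L R i) : T ≤ ofMask n L R := by
  have key : ∀ m, T.z m → maskZ L R m := by
    intro m
    induction m with
    | zero => exact fun h => absurd h T.not_z_zero
    | succ m ih =>
      intro h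
      have := hz m h
      have := hLR m
      simp only [maskZ]
      tauto
  exact ⟨fun i h => ⟨T.le_of_z i h, key i h⟩,
    fun i h => ⟨T.lt_of_z_succ (T.z_of_x h).2, key i (T.z_of_x h).1, hL i h⟩,
    fun i h => ⟨T.lt_of_z_succ (T.z_of_y h).2, key i (T.z_of_y h).1, hR i h⟩⟩

theorem maskZ_eq {T : AdmissibleSet n} {L R : ℕ → Prop}
    (h : ∀ m, L m ∨ R m ↔ T.z (m + 1)) (h' : ∀ m, ¬ T.z m → ¬ (L m ∧ R m)) (m : ℕ) :
    maskZ L R m ↔ T.z m := by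
  induction m with
  | zero => simp [maskZ, T.not_z_zero]
  | succ m ih =>
    have := h m
    have := h' m
    simp only [maskZ]
    tauto

/-- Below any admissible set `T'` and above any smaller `T`, one finds an admissible set obtained
by removing a letter from the canonical subword of `T'`. -/
theorem exists_remove_letter {T T' : AdmissibleSet n} (h : T < T') :
    ∃ L R : ℕ → Prop, T ≤ ofMask n L R ∧ ofMask n L R < T' ∧ ∃ i,
      (L = fun m => T'.left m ∧ m ≠ i) ∧ R = T'.y ∨
      L = T'.left ∧ R = fun m => T'.y m ∧ m ≠ i := by
  obtain ⟨hz, hx, hy⟩ := le_def.1 h.le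
  by_cases hb : ∃ i, T'.x i ∧ T'.y i ∧ ¬ (T.x i ∧ T.y i)
  -- Two letters `i` are present and T lacks one of them. Dropping that one leaves a copy of `i`, so
  -- no `z` changes.
  · obtain ⟨i, hxi, hyi, hi⟩ := hb
    have hzi := T'.z_of_x hxi
    by_cases hTx : T.x i
    · have hTy : ¬ T.y i := fun h => hi ⟨hTx, h⟩
      refine ⟨T'.left, fun m => T'.y m ∧ m ≠ i, ?_, ?_, i, Or.inr ⟨rfl, rfl⟩⟩
      · have h1 : ∀ m, maskZ T'.left (fun m => T'.y m ∧ m ≠ i) m ↔ T'.z m := by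
          refine maskZ_eq (fun m => ?_) fun m hm hm' => hm (T'.z_of_y hm'.2.1).1
          rw [← T'.left_or_y]
          rcases eq_or_ne m i with rfl | hmi
          · simp [hyi, left, hxi]
          · simp [hmi]
        refine le_ofMask (fun m hm => Or.inl (hx m hm)) (fun m hm => ⟨hy m hm, ?_⟩) (fun m hm => ?_)
          fun m hm hm' => Or.inr ((h1 m).2 (T'.z_of_y hm'.1).1)
        · rintro rfl
          exact hTy hm
        · have := (T'.left_or_y (m := m)).2 (hz _ hm)
          rcases eq_or_ne m i with rfl | hmi
          · exact Or.inl (Or.inl hxi)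
          · simpa [hmi] using this
      · refine lt_of_le_of_ne (ofMask_le (fun _ h => h) fun _ h => h.1) fun he => ?_
        have := (congrFun (congrArg AdmissibleSet.y he) i).symm ▸ hyi
        exact this.2.2.2 rfl
    · refine ⟨fun m => T'.left m ∧ m ≠ i, T'.y, ?_, ?_, i, Or.inl ⟨rfl, rfl⟩⟩
      · have h1 : ∀ m, maskZ (fun m => T'.left m ∧ m ≠ i) T'.y m ↔ T'.z m := by
          refine maskZ_eq (fun m => ?_) fun m hm hm' => hm (T'.z_of_y hm'.2).1
          rw [← T'.left_or_y]
          rcases eq_or_ne m i with rfl | hmi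
          · simp [hyi]
          · simp [hmi]
        refine le_ofMask (fun m hm => ⟨Or.inl (hx m hm), ?_⟩) (fun m hm => hy m hm) (fun m hm => ?_)
          fun m hm hm' => Or.inr ((h1 m).2 (T'.z_of_y hm').1)
        · rintro rfl
          exact hTx hm
        · have := (T'.left_or_y (m := m)).2 (hz _ hm)
          rcases eq_or_ne m i with rfl | hmi
          · exact Or.inr hyi
          · simpa [hmi] using this
      · refine lt_of_le_of_ne (ofMask_le (fun _ h => h.1) fun _ h => h) fun he => ?_
        have := (congrFun (congrArg AdmissibleSet.x he) i).symm ▸ hxi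
        exact this.2.2.2 rfl
  · have hboth : ∀ m, T'.x m → T'.y m → T.x m ∧ T.y m := by
      intro m h1 h2
      by_contra h3
      exact hb ⟨m, h1, h2, h3⟩
    -- All double letters of `T'` are double in T, so equal `z` would force equal `x` and `y`. Some
    -- `z (i + 1)` therefore differs, and letter `i` occurs once and is the one to drop.
    obtain ⟨i, hi, hi'⟩ : ∃ i, T'.z (i + 1) ∧ ¬ T.z (i + 1) := by
      by_contra hcon
      have hzz : ∀ i, T'.z i → T.z i := by
        intro i
        cases i with
        | zero => exact fun h => absurd h T'.not_z_zero
        | succ i =>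
          intro h1
          by_contra h2
          exact hcon ⟨i, h1, h2⟩
      refine absurd h (not_lt_of_ge ⟨hzz, fun m hm => ?_, fun m hm => ?_⟩)
      · have h1 := T'.z_of_x hm
        have h2 := (T.x_or_y_iff m).2 ⟨hzz _ h1.1, hzz _ h1.2⟩
        have := hy m
        have := hboth m hm
        tauto
      · have h1 := T'.z_of_y hm
        have h2 := (T.x_or_y_iff m).2 ⟨hzz _ h1.1, hzz _ h1.2⟩
        have := hx m
        have := fun h => hboth m h hm
        tauto
    have hsingle : ¬ (T'.left i ∧ T'.y i) := by
      rintro ⟨h1, h2⟩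
      rcases h1 with h1 | h1
      · exact hi' (T.z_of_x (hboth i h1 h2).1).2
      · exact h1.1 (T'.z_of_y h2).1
    have hLR : ∀ m, T'.left m → T'.y m → T.z m := by
      rintro m (h1 | h1) h2
      · exact (T.z_of_x (hboth m h1 h2).1).1
      · exact absurd (T'.z_of_y h2).1 h1.1
    by_cases hL : T'.left i
    · refine ⟨fun m => T'.left m ∧ m ≠ i, T'.y, ?_, ?_, i, Or.inl ⟨rfl, rfl⟩⟩
      · refine le_ofMask (fun m hm => ⟨Or.inl (hx m hm), ?_⟩) (fun m hm => hy m hm) (fun m hm => ?_)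
          fun m hm hm' => Or.inl (hLR m hm.1 hm')
        · rintro rfl
          exact hi' (T.z_of_x hm).2
        · have := (T'.left_or_y (m := m)).2 (hz _ hm)
          rcases eq_or_ne m i with rfl | hmi
          · exact absurd hm hi'
          · simpa [hmi] using this
      · refine lt_of_le_of_ne (ofMask_le (fun _ h => h.1) fun _ h => h) fun he => ?_
        have := (congrFun (congrArg AdmissibleSet.z he) (i + 1)).symm ▸ hi
        have h1 := this.2
        simp only [maskZ] at h1
        tauto
    · refine ⟨T'.left, fun m => T'.y m ∧ m ≠ i, ?_, ?_, i, Or.inr ⟨rfl, rfl⟩⟩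
      · refine le_ofMask (fun m hm => Or.inl (hx m hm)) (fun m hm => ⟨hy m hm, ?_⟩) (fun m hm => ?_)
          fun m hm hm' => Or.inl (hLR m hm hm'.1)
        · rintro rfl
          exact hi' (T.z_of_y hm).2
        · have := (T'.left_or_y (m := m)).2 (hz _ hm)
          rcases eq_or_ne m i with rfl | hmi
          · exact absurd hm hi'
          · simpa [hmi] using this
      · refine lt_of_le_of_ne (ofMask_le (fun _ h => h) fun _ h => h.1) fun he => ?_
        have := (congrFun (congrArg AdmissibleSet.z he) (i + 1)).symm ▸ hi
        have h1 := this.2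
        simp only [maskZ] at h1
        tauto

/-- The largest admissible set. -/
def top (n : ℕ) : AdmissibleSet n where
  z i := i ≠ 0 ∧ i ≤ n
  x i := i ≠ 0 ∧ i < n
  y i := i ≠ 0 ∧ i < n
  not_z_zero := by simp
  x_or_y_iff i := by omega
  le_of_z i h := h.2

theorem le_top (T : AdmissibleSet n) : T ≤ top n := by
  have h0 : ∀ i, T.z i → i ≠ 0 := by
    rintro i h rfl
    exact T.not_z_zero h
  exact ⟨fun i h => ⟨h0 i h, T.le_of_z i h⟩,
    fun i h => ⟨h0 i (T.z_of_x h).1, T.lt_of_z_succ (T.z_of_x h).2⟩,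
    fun i h => ⟨h0 i (T.z_of_y h).1, T.lt_of_z_succ (T.z_of_y h).2⟩⟩

end AdmissibleSet

/-! ### Permutation model of type `A` -/

namespace CoxeterMatrix

/-- The symmetric group satisfies the relations of type `A`. -/
theorem isLiftable_swap (n : ℕ) :
    (CoxeterMatrix.A n).IsLiftable fun i : Fin n => Equiv.swap (i : ℕ) (i + 1) := by
  have braid : ∀ a : ℕ, (Equiv.swap a (a + 1) * Equiv.swap (a + 1) (a + 2)) ^ 3 = 1 := by
    intro a
    have h1 := Equiv.swap_mul_swap_mul_swap (x := a) (y := a + 1) (z := a + 2)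
      (by omega) (by omega)
    have h2 := Equiv.swap_mul_swap_mul_swap (x := a + 2) (y := a + 1) (z := a)
      (by omega) (by omega)
    rw [Equiv.swap_comm (a + 1) a, Equiv.swap_comm (a + 2) (a + 1)] at h2
    calc _ = (Equiv.swap a (a + 1) * Equiv.swap (a + 1) (a + 2) * Equiv.swap a (a + 1)) *
        (Equiv.swap (a + 1) (a + 2) * Equiv.swap a (a + 1) * Equiv.swap (a + 1) (a + 2)) := by
          simp only [pow_succ, pow_zero, one_mul, mul_assoc]
      _ = 1 := by rw [h1, h2, Equiv.swap_comm, Equiv.swap_mul_self]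
  intro i j
  simp only [CoxeterMatrix.A, Matrix.of_apply]
  split_ifs with h1 h2
  · subst h1
    simp
  · rcases h2 with h2 | h2
    · have := congrArg (fun g => g⁻¹) (braid j)
      simpa [← h2, ← inv_pow, mul_inv_rev, add_assoc] using this
    · simpa [← h2, add_assoc] using braid i
  · have hd : Equiv.Perm.Disjoint (Equiv.swap (i : ℕ) (i + 1)) (Equiv.swap (j : ℕ) (j + 1)) := by
      intro a
      have := Fin.val_ne_of_ne h1
      by_cases ha : a = i ∨ a = i + 1
      · exact Or.inr (Equiv.swap_apply_of_ne_of_ne (by omega) (by omega))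
      · exact Or.inl (Equiv.swap_apply_of_ne_of_ne (by omega) (by omega))
    rw [hd.commute.mul_pow, pow_two, pow_two]
    simp

end CoxeterMatrix

/-! ### Admissible sets as a Bruhat interval -/

namespace AdmissibleSet

variable {n : ℕ} {W : Type*} [Group W] (cs : CoxeterSystem (CoxeterMatrix.A n) W)

theorem wordProd_maskWord_succ (L R : ℕ → Prop) [DecidablePred L] [DecidablePred R] {m : ℕ}
    (hm : m < n) :
    cs.wordProd (maskWord n L R (m + 1)) = (if L m then cs.simple ⟨m, hm⟩ else 1) *
      cs.wordProd (maskWord n L R m) * (if R m then cs.simple ⟨m, hm⟩ else 1) := by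
  simp only [maskWord, cs.wordProd_append]
  congr 2
  · split_ifs <;> simp [letter, hm]
  · split_ifs <;> simp [letter, hm]

theorem commute_simple {i j : Fin n} (h : (i : ℕ) + 1 < j) :
    Commute (cs.simple j) (cs.simple i) := by
  have h1 := cs.simple_mul_simple_pow j i
  have h2 : (CoxeterMatrix.A n) j i = 2 := by
    change (if j = i then 1 else (if (i : ℕ) + 1 = j ∨ (j : ℕ) + 1 = i then 3 else 2)) = 2
    rw [if_neg (by rintro rfl; omega), if_neg (by omega)]
  rw [h2, pow_two, mul_eq_one_iff_eq_inv, mul_inv_rev, cs.inv_simple, cs.inv_simple] at h1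
  exact h1

/-- For `m < j` all letters are at distance at least 2 from `j`. For `m = j`, letter `m - 1` is
absent or its two copies cancel, which reduces to a shorter word. -/
theorem commute_maskWord (L R : ℕ → Prop) {m : ℕ} (j : Fin n)
    (h : m < j ∨ m = j ∧ ¬ maskZ L R m) :
    Commute (cs.simple j) (cs.wordProd (maskWord n L R m)) := by
  classical
  induction m generalizing j with
  | zero => simp [maskWord]
  | succ m ih =>
    have hm : m < n := by omega
    rw [wordProd_maskWord_succ cs L R hm]
    by_cases hj : m + 1 < j
    · have h1 : Commute (cs.simple j) (cs.simple ⟨m, hm⟩) := commute_simple cs hj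
      have h2 := ih j (Or.inl (by omega))
      refine Commute.mul_right (Commute.mul_right ?_ h2) ?_ <;> split_ifs <;>
        simp [h1, Commute.one_right]
    · have hj' : m + 1 = j := by omega
      have hZ := (h.resolve_left (by omega)).2
      have h2 := ih j (Or.inl (by omega))
      simp only [maskZ] at hZ
      by_cases hL : L m
      · have hR : R m := by tauto
        have h3 := ih ⟨m, hm⟩ (Or.inr ⟨rfl, by tauto⟩)
        rw [if_pos hL, if_pos hR, h3.eq]
        simpa using h2
      · have hR : ¬ R m := by tauto
        rw [if_neg hL, if_neg hR]
        simpa using h2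

/-- The Coxeter group element attached to an admissible set. -/
noncomputable def toCoxeter (T : AdmissibleSet n) : W :=
  cs.wordProd (maskWord n T.left T.y n)

/-- The words differ only at letters `m` for which `m - 1` does not survive. There `m` commutes with
the inner product, so a right copy can move left and a pair can cancel. -/
theorem toCoxeter_ofMask (L R : ℕ → Prop) :
    toCoxeter cs (ofMask n L R) = cs.wordProd (maskWord n L R n) := by
  classical
  suffices h : ∀ m ≤ n, cs.wordProd (maskWord n (ofMask n L R).left (ofMask n L R).y m) =
      cs.wordProd (maskWord n L R m) from h n le_rfl
  intro m
  induction m with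
  | zero => simp [maskWord]
  | succ m ih =>
    intro hm
    have hm' : m < n := hm
    rw [wordProd_maskWord_succ cs _ _ hm', wordProd_maskWord_succ cs _ _ hm', ih hm'.le]
    by_cases hZ : maskZ L R m
    · have h1 : (ofMask n L R).left m ↔ L m := by
        simp [left, ofMask, hZ, hm', hm'.le]
      have h2 : (ofMask n L R).y m ↔ R m := by
        simp [ofMask, hZ, hm']
      simp only [h1, h2]
    · have h1 : (ofMask n L R).left m ↔ (L m ∧ ¬ R m ∨ R m ∧ ¬ L m) := by
        simp [left, ofMask, hZ, hm', maskZ]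
      have h2 : ¬ (ofMask n L R).y m := by
        simp [ofMask, hZ]
      have h3 := commute_maskWord cs L R (m := m) ⟨m, hm'⟩ (Or.inr ⟨rfl, hZ⟩)
      by_cases hL : L m <;> by_cases hR : R m <;> simp only [h1, h2, hL, hR] <;>
        simp [h3.eq]

/-- The homomorphism to permutations of the natural numbers. -/
noncomputable def permHom : W →* Equiv.Perm ℕ :=
  cs.lift ⟨_, CoxeterMatrix.isLiftable_swap n⟩

theorem permHom_simple (i : Fin n) : permHom cs (cs.simple i) = Equiv.swap (i : ℕ) (i + 1) :=
  cs.lift_apply_simple (CoxeterMatrix.isLiftable_swap n) i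

/-- The permutations attached to the initial parts of the canonical word. -/
noncomputable def perm (T : AdmissibleSet n) (m : ℕ) : Equiv.Perm ℕ :=
  permHom cs (cs.wordProd (maskWord n T.left T.y m))

theorem perm_succ (T : AdmissibleSet n) [DecidablePred T.left] [DecidablePred T.y] {m : ℕ}
    (hm : m < n) :
    T.perm cs (m + 1) = (if T.left m then Equiv.swap m (m + 1) else 1) * T.perm cs m *
      (if T.y m then Equiv.swap m (m + 1) else 1) := by
  rw [perm, wordProd_maskWord_succ cs _ _ hm, map_mul, map_mul, apply_ite (permHom cs),
    apply_ite (permHom cs), map_one, permHom_simple]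
  rfl

/-- The inner permutation fixes `m + 1`, and it sends `m` below `m` whenever a right letter `m` is
present. So `m + 1` is moved exactly when some letter `m` occurs. -/
theorem perm_spec (T : AdmissibleSet n) {m : ℕ} (hm : m ≤ n) :
    (∀ a, m < a → T.perm cs m a = a) ∧ (T.z m ↔ T.perm cs m m ≠ m) := by
  classical
  induction m with
  | zero => simp [perm, maskWord, T.not_z_zero]
  | succ m ih =>
    obtain ⟨h1, h2⟩ := ih (by omega)
    have hxy := T.x_or_y_iff m
    refine ⟨fun a ha => ?_, ?_⟩
    · rw [perm_succ cs T hm, Equiv.Perm.mul_apply, Equiv.Perm.mul_apply]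
      have h3 : ∀ p : Prop, ∀ [Decidable p],
          (if p then Equiv.swap m (m + 1) else (1 : Equiv.Perm ℕ)) a = a := by
        intro p _
        split_ifs
        · exact Equiv.swap_apply_of_ne_of_ne (by omega) (by omega)
        · rfl
      rw [h3, h1 a (by omega), h3]
    · have h3 : T.perm cs m m ≠ m + 1 := by
        intro h
        have := (T.perm cs m).injective (h.trans (h1 (m + 1) (by omega)).symm)
        omega
      have h4 := h1 (m + 1) (by omega)
      have h5 : T.left m ↔ T.x m ∨ (¬ T.z m ∧ T.z (m + 1)) := Iff.rfl
      rw [perm_succ cs T hm, Equiv.Perm.mul_apply, Equiv.Perm.mul_apply]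
      by_cases hL : T.left m <;> by_cases hR : T.y m <;> simp only [hL, hR, if_true, if_false]
      · have hz := T.z_of_y hR
        simp [Equiv.swap_apply_of_ne_of_ne (h2.1 hz.1) h3, hz.2, h3]
      · have : T.z (m + 1) := by tauto
        simp [h4, this]
      · have hz := T.z_of_y hR
        simp [hz.2, h3]
      · have : ¬ T.z (m + 1) := by tauto
        simp [h4, this]

/-- The point `m + 1` stays fixed without letters, goes to `m` with the left letter alone, and goes
below `m` with the right letter. In the last case `m` is fixed exactly when the left letter is there
too. -/
theorem perm_succ_letters (T : AdmissibleSet n) {m : ℕ} (hm : m < n) :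
    (T.y m ↔ T.perm cs (m + 1) (m + 1) ≠ m + 1 ∧ T.perm cs (m + 1) (m + 1) ≠ m) ∧
    (T.left m ↔ T.perm cs (m + 1) (m + 1) ≠ m + 1 ∧
      (T.perm cs (m + 1) (m + 1) = m ∨ T.perm cs (m + 1) m = m)) := by
  classical
  obtain ⟨h1, h2⟩ := perm_spec cs T hm.le
  have h3 : T.perm cs m m ≠ m + 1 := by
    intro h
    have := (T.perm cs m).injective (h.trans (h1 (m + 1) (by omega)).symm)
    omega
  have h4 := h1 (m + 1) (by omega)
  rw [perm_succ cs T hm]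
  simp only [Equiv.Perm.mul_apply]
  by_cases hL : T.left m <;> by_cases hR : T.y m <;> simp only [hL, hR, if_true, if_false]
  · have hz := T.z_of_y hR
    have := Equiv.swap_apply_of_ne_of_ne (h2.1 hz.1) h3
    simp [this, h3, h4, h2.1 hz.1]
  · simp [h4]
  · have hz := T.z_of_y hR
    simp [h3, h4, h2.1 hz.1]
  · simp [h4]

theorem toCoxeter_injective : Function.Injective (toCoxeter (n := n) cs) := by
  classical
  intro S T h
  -- The outermost letters can be read off the permutation and stripped, from `n` downwards.
  have h1 : ∀ d m, m + d = n → S.perm cs m = T.perm cs m := by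
    intro d
    induction d with
    | zero =>
      rintro m rfl
      exact congrArg (permHom cs) h
    | succ d ih =>
      intro m hm
      have hmn : m < n := by omega
      have h2 := ih (m + 1) (by omega)
      have hS := perm_succ_letters cs S hmn
      have hT := perm_succ_letters cs T hmn
      rw [h2] at hS
      rw [perm_succ cs S hmn, perm_succ cs T hmn] at h2
      simp only [hS.1.trans hT.1.symm, hS.2.trans hT.2.symm] at h2
      exact mul_left_cancel (mul_right_cancel h2)
  have hz : ∀ m, S.z m ↔ T.z m := by
    intro m
    by_cases hm : m ≤ n
    · rw [(perm_spec cs S hm).2, (perm_spec cs T hm).2, h1 (n - m) m (by omega)]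
    · exact ⟨fun h => absurd (S.le_of_z m h) hm, fun h => absurd (T.le_of_z m h) hm⟩
  have hyx : ∀ m, (S.y m ↔ T.y m) ∧ (S.x m ↔ T.x m) := by
    intro m
    have hx : ∀ U : AdmissibleSet n, U.x m ↔ U.left m ∧ U.z m := fun U => by
      have := U.z_of_x (i := m)
      unfold left
      tauto
    rw [hx, hx, hz]
    by_cases hm : m < n
    · have hS := perm_succ_letters cs S hm
      have hT := perm_succ_letters cs T hm
      rw [h1 (n - (m + 1)) (m + 1) (by omega)] at hS
      rw [hS.1.trans hT.1.symm, hS.2.trans hT.2.symm]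
      exact ⟨Iff.rfl, Iff.rfl⟩
    · have h2 : ∀ U : AdmissibleSet n, ¬ U.left m ∧ ¬ U.y m := fun U => by
        have := U.left_or_y (m := m)
        have := U.lt_of_z_succ (i := m)
        tauto
      have := h2 S
      have := h2 T
      tauto
  ext m
  · exact hz m
  · exact (hyx m).2
  · exact (hyx m).1

theorem exists_of_bruhatLE {T : AdmissibleSet n} {u : W} (h : cs.BruhatLE u (toCoxeter cs T)) :
    ∃ S ≤ T, u = toCoxeter cs S := by
  obtain ⟨ω, h1, rfl⟩ := h.exists_sublist cs _ rfl
  obtain ⟨L, R, hL, hR, rfl⟩ := exists_mask_of_sublist h1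
  exact ⟨ofMask n L R, ofMask_le hL hR, (toCoxeter_ofMask cs L R).symm⟩

/-- Deleting a letter multiplies on the right by its conjugate by the part of the word after it;
nothing changes if the letter was absent. -/
theorem remove_letter (L R L' R' : ℕ → Prop) (i : ℕ)
    (h : (L = fun m => L' m ∧ m ≠ i) ∧ R = R' ∨ L = L' ∧ R = fun m => R' m ∧ m ≠ i) {m : ℕ}
    (hm : m ≤ n) :
    cs.wordProd (maskWord n L R m) = cs.wordProd (maskWord n L' R' m) ∨ ∃ t, cs.IsReflection t ∧
      cs.wordProd (maskWord n L R m) = cs.wordProd (maskWord n L' R' m) * t := by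
  classical
  induction m with
  | zero => exact Or.inl rfl
  | succ m ih =>
    rw [wordProd_maskWord_succ cs _ _ hm, wordProd_maskWord_succ cs _ _ hm]
    rcases eq_or_ne m i with rfl | hi
    · have h1 : maskWord n L R m = maskWord n L' R' m := by
        refine maskWord_congr (fun j hj => ?_) fun j hj => ?_ <;>
          rcases h with ⟨rfl, rfl⟩ | ⟨rfl, rfl⟩ <;> simp [hj.ne]
      rw [h1]
      rcases h with ⟨rfl, rfl⟩ | ⟨rfl, rfl⟩
      · by_cases hL : L' m
        · right
          refine ⟨_, (cs.isReflection_simple ⟨m, hm⟩).conj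
            (cs.wordProd (maskWord n L' R m) * (if R m then cs.simple ⟨m, hm⟩ else 1))⁻¹, ?_⟩
          simp only [hL, ne_eq, not_true_eq_false, and_false, if_false, if_true]
          generalize (if R m then cs.simple ⟨m, hm⟩ else 1) = r
          simp [mul_assoc]
        · left
          simp [hL]
      · by_cases hR : R' m
        · right
          refine ⟨_, cs.isReflection_simple ⟨m, hm⟩, ?_⟩
          simp [hR]
        · left
          simp [hR]
    · have hL : L m ↔ L' m := by
        rcases h with ⟨rfl, rfl⟩ | ⟨rfl, rfl⟩ <;> simp [hi]
      have hR : R m ↔ R' m := by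
        rcases h with ⟨rfl, rfl⟩ | ⟨rfl, rfl⟩ <;> simp [hi]
      simp only [hL, hR]
      rcases ih (by omega) with ih | ⟨t, ht, ih⟩
      · rw [ih]
        exact Or.inl rfl
      · right
        refine ⟨_, ht.conj (if R' m then cs.simple ⟨m, hm⟩ else 1)⁻¹, ?_⟩
        rw [ih]
        generalize (if R' m then cs.simple ⟨m, hm⟩ else 1) = r
        simp [mul_assoc]

/-- No length is computed. Elements differing by a reflection are comparable, and the wrong
direction would, by `exists_of_bruhatLE` and injectivity, make T at most its proper subset `ofMask n
L R`. -/
theorem bruhatLE_of_le {S T : AdmissibleSet n} (h : S ≤ T) :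
    cs.BruhatLE (toCoxeter cs S) (toCoxeter cs T) := by
  induction T using WellFoundedLT.induction with
  | ind T ih =>
    rcases h.eq_or_lt with rfl | hlt
    · exact Relation.ReflTransGen.refl
    · obtain ⟨L, R, h1, h2, i, hi⟩ := exists_remove_letter hlt
      refine (ih _ h2 h1).trans ?_
      have h3 := remove_letter cs _ _ _ _ i hi le_rfl
      rw [← toCoxeter_ofMask] at h3
      rcases h3 with h3 | ⟨t, ht, h3⟩
      · rw [h3]
        exact Relation.ReflTransGen.refl
      · change _ = toCoxeter cs T * t at h3
        rcases ht.bruhatLE_or cs (toCoxeter cs T) with h4 | h4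
        · rw [← h3] at h4
          obtain ⟨U, hU, hUT⟩ := exists_of_bruhatLE cs h4
          rw [toCoxeter_injective cs hUT] at h2
          exact absurd h2 (not_lt_of_ge hU)
        · rwa [h3]

theorem maskWord_true (m : ℕ) (hm : m ≤ n) :
    maskWord n (fun _ => True) (fun i => i ≠ 0) m =
      ((List.finRange n).take m).reverse ++ ((List.finRange n).take m).tail := by
  induction m with
  | zero => simp [maskWord]
  | succ m ih =>
    have hm' : m < n := hm
    have h1 : (List.finRange n).take (m + 1) = (List.finRange n).take m ++ [⟨m, hm'⟩] := by
      rw [List.take_add_one, List.getElem?_eq_getElem (by simpa using hm')]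
      simp
    rw [maskWord, ih hm'.le, h1]
    rcases Nat.eq_zero_or_pos m with rfl | h0
    · simp [letter, hm']
    · rw [List.tail_append_of_ne_nil]
      · simp [letter, hm', h0.ne']
      · intro h
        have := congrArg List.length h
        simp at this
        omega

theorem toCoxeter_top : toCoxeter cs (top n) = cs.wordProd (palindromeWord n) := by
  have h1 : palindromeWord n = maskWord n (fun _ => True) (fun i => i ≠ 0) n := by
    rw [maskWord_true n le_rfl, List.take_of_length_le (by simp), palindromeWord]
  rw [h1, toCoxeter]
  congr 1
  -- The single middle letter 0 is a left letter of `top n`, because `z 0` fails and `z 1` holds.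
  refine maskWord_congr (fun i hi => ?_) fun i hi => ?_
  · simp only [left, top, iff_true]
    omega
  · simp only [top]
    omega

/-- Admissible sets form the Bruhat interval below the palindrome word. -/
theorem nonempty_orderIso_bruhatInterval :
    Nonempty (AdmissibleSet n ≃o cs.BruhatInterval (cs.wordProd (palindromeWord n))) := by
  let f : AdmissibleSet n → cs.BruhatInterval (cs.wordProd (palindromeWord n)) := fun T =>
    ⟨toCoxeter cs T, toCoxeter_top cs ▸ bruhatLE_of_le cs T.le_top⟩
  have hf : ∀ S T, f S ≤ f T ↔ S ≤ T := by
    intro S T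
    refine ⟨fun h => ?_, fun h => bruhatLE_of_le cs h⟩
    obtain ⟨U, hU, hSU⟩ := exists_of_bruhatLE cs (show cs.BruhatLE _ (toCoxeter cs T) from h)
    rwa [toCoxeter_injective cs hSU]
  refine ⟨RelIso.ofSurjective (OrderEmbedding.ofMapLEIff f hf) ?_⟩
  rintro ⟨u, hu⟩
  rw [← toCoxeter_top] at hu
  obtain ⟨S, -, hS⟩ := exists_of_bruhatLE cs hu
  exact ⟨S, Subtype.ext hS.symm⟩

end AdmissibleSet

namespace QWeyl

variable {k : Type*} [Field k] {n : ℕ} {Q : Fin n → kˣ} {Γ : Matrix (Fin n) (Fin n) k}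

/-! ### Relations -/

theorem Y_mul_Y (i j : Fin n) : Y Q Γ i * Y Q Γ j = Γ i j • (Y Q Γ j * Y Q Γ i) := by
  simpa only [X, Y, map_mul, map_smul] using RingQuot.mkAlgHom_rel k (QWeylRel.yy (Q := Q) (Γ := Γ) i j)

theorem X_mul_Y_of_lt {i j : Fin n} (h : i < j) :
    X Q Γ i * Y Q Γ j = Γ j i • (Y Q Γ j * X Q Γ i) := by
  simpa only [X, Y, map_mul, map_smul] using
    RingQuot.mkAlgHom_rel k (QWeylRel.xy_lt (Q := Q) (Γ := Γ) i j h)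

theorem X_mul_Y_of_gt {i j : Fin n} (h : j < i) :
    X Q Γ i * Y Q Γ j = ((Q j : k) * Γ j i) • (Y Q Γ j * X Q Γ i) := by
  simpa only [X, Y, map_mul, map_smul] using
    RingQuot.mkAlgHom_rel k (QWeylRel.xy_gt (Q := Q) (Γ := Γ) i j h)

theorem X_mul_X_of_lt {i j : Fin n} (h : i < j) :
    X Q Γ i * X Q Γ j = ((Q i : k) * Γ i j) • (X Q Γ j * X Q Γ i) := by
  simpa only [X, Y, map_mul, map_smul] using
    RingQuot.mkAlgHom_rel k (QWeylRel.xx (Q := Q) (Γ := Γ) i j h)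

variable (Q Γ) in
/-- The normal elements `z_m = 1 + ∑_{l < m} (q_l - 1) y_l x_l` (with indices from `0`). -/
def Z (m : ℕ) : QWeyl Q Γ :=
  1 + ∑ l ∈ Finset.univ.filter fun l : Fin n => (l : ℕ) < m,
    ((Q l : k) - 1) • (Y Q Γ l * X Q Γ l)

theorem Z_zero : Z Q Γ 0 = 1 := by simp [Z]

theorem Z_succ (i : Fin n) :
    Z Q Γ (i + 1) = Z Q Γ i + ((Q i : k) - 1) • (Y Q Γ i * X Q Γ i) := by
  have h : (Finset.univ.filter fun l : Fin n => (l : ℕ) < i + 1) =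
      insert i (Finset.univ.filter fun l : Fin n => (l : ℕ) < i) := by
    ext l
    simp only [Finset.mem_filter, Finset.mem_univ, true_and, Finset.mem_insert, Fin.ext_iff]
    omega
  rw [Z, h, Finset.sum_insert (by simp), Z]
  abel

theorem Z_succ_of_le {m : ℕ} (h : n ≤ m) : Z Q Γ (m + 1) = Z Q Γ m := by
  rw [Z, Z]
  congr 2
  ext l
  simp only [Finset.mem_filter, Finset.mem_univ, true_and]
  omega

theorem X_mul_Y_self (i : Fin n) :
    X Q Γ i * Y Q Γ i = (Q i : k) • (Y Q Γ i * X Q Γ i) + Z Q Γ i := by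
  have h := RingQuot.mkAlgHom_rel k (QWeylRel.xy_eq (Q := Q) (Γ := Γ) i)
  simp only [map_mul, map_smul, map_add, map_one, map_sum] at h
  refine h.trans ?_
  rw [Z, add_assoc]
  congr 3
  ext l
  simp

variable (Q Γ) in
/-- The generators: `G true = X`, `G false = Y`. -/
def G : Bool → Fin n → QWeyl Q Γ
  | true => X Q Γ
  | false => Y Q Γ

@[elab_as_elim]
theorem induction_on {p : QWeyl Q Γ → Prop} (a : QWeyl Q Γ)
    (smul_one : ∀ r : k, p (r • 1)) (gen : ∀ ε i, p (G Q Γ ε i))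
    (add : ∀ a b, p a → p b → p (a + b)) (mul : ∀ a b, p a → p b → p (a * b)) : p a := by
  obtain ⟨a, rfl⟩ := RingQuot.mkAlgHom_surjective k (QWeylRel Q Γ) a
  induction a using FreeAlgebra.induction with
  | grade0 r => simpa [Algebra.algebraMap_eq_smul_one] using smul_one r
  | grade1 g =>
    cases g with
    | x i => exact gen true i
    | y i => exact gen false i
  | mul a b ha hb => simpa using mul _ _ ha hb
  | add a b ha hb => simpa using add _ _ ha hb

/-- Commutation up to a nonzero scalar. -/
def SkewCommute (k : Type*) [Field k] {A : Type*} [Ring A] [Algebra k A] (a b : A) : Prop :=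
  ∃ κ : k, κ ≠ 0 ∧ a * b = κ • (b * a)

namespace SkewCommute

variable {A : Type*} [Ring A] [Algebra k A] {a b c : A}

theorem symm (h : SkewCommute k a b) : SkewCommute k b a := by
  obtain ⟨κ, h0, h⟩ := h
  exact ⟨κ⁻¹, inv_ne_zero h0, by rw [h, smul_smul, inv_mul_cancel₀ h0, one_smul]⟩

theorem of_commute (h : Commute a b) : SkewCommute k a b := ⟨1, one_ne_zero, by rw [one_smul, h.eq]⟩

theorem mul_right (h : SkewCommute k a b) (h' : SkewCommute k a c) : SkewCommute k a (b * c) := by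
  obtain ⟨κ, h0, h⟩ := h
  obtain ⟨κ', h0', h'⟩ := h'
  refine ⟨κ * κ', mul_ne_zero h0 h0', ?_⟩
  rw [← mul_assoc, h, smul_mul_assoc, mul_assoc, h', mul_smul_comm, smul_smul, mul_assoc]

theorem pow_right (h : SkewCommute k a b) (m : ℕ) : SkewCommute k a (b ^ m) := by
  induction m with
  | zero => exact of_commute (by simp)
  | succ m ih =>
    rw [pow_succ]
    exact ih.mul_right h

theorem pow_left (h : SkewCommute k a b) (m : ℕ) : SkewCommute k (a ^ m) b :=
  (h.symm.pow_right m).symm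

theorem list_prod_right {ι : Type*} {f : ι → A} {l : List ι} (h : ∀ i ∈ l, SkewCommute k a (f i)) :
    SkewCommute k a (l.map f).prod := by
  induction l with
  | nil => exact of_commute (by simp)
  | cons i l ih =>
    rw [List.map_cons, List.prod_cons]
    exact (h i (by simp)).mul_right (ih fun j hj => h j (by simp [hj]))

/-- Pulling a factor of a product to the front. -/
theorem exists_list_prod_eq {ι : Type*} [DecidableEq ι] {f : ι → A} {l : List ι} (hl : l.Nodup)
    {i : ι} (hi : i ∈ l) (h : ∀ j, j ≠ i → SkewCommute k (f j) (f i)) :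
    ∃ κ : k, κ ≠ 0 ∧ (l.map f).prod = κ • (f i * (l.map (Function.update f i 1)).prod) := by
  induction l with
  | nil => simp at hi
  | cons j l ih =>
    rw [List.nodup_cons] at hl
    simp only [List.map_cons, List.prod_cons]
    rcases eq_or_ne j i with rfl | hj
    · refine ⟨1, one_ne_zero, ?_⟩
      rw [Function.update_self, one_mul, one_smul]
      congr 2
      refine List.map_congr_left fun a ha => ?_
      rw [Function.update_of_ne]
      rintro rfl
      exact hl.1 ha
    · obtain ⟨κ, h0, h1⟩ := ih hl.2 (by simpa [hj.symm] using hi)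
      obtain ⟨κ', h0', h1'⟩ := h j hj
      refine ⟨κ * κ', mul_ne_zero h0 h0', ?_⟩
      rw [h1, Function.update_of_ne hj, mul_smul_comm, ← mul_assoc, h1', smul_mul_assoc, smul_smul,
        mul_assoc]

end SkewCommute

section

variable (hΓ : ∀ i j, Γ i j * Γ j i = 1)
include hΓ

theorem skewCommute_G {i j : Fin n} (h : i ≠ j) (ε δ : Bool) :
    SkewCommute k (G Q Γ ε i) (G Q Γ δ j) := by
  have hne : ∀ i j, Γ i j ≠ 0 := fun i j h => by simpa [h] using hΓ i j
  have hXY : ∀ i j, i ≠ j → SkewCommute k (X Q Γ i) (Y Q Γ j) := fun i j h => by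
    rcases lt_or_gt_of_ne h with h | h
    · exact ⟨_, hne _ _, X_mul_Y_of_lt h⟩
    · exact ⟨_, mul_ne_zero (Q j).ne_zero (hne _ _), X_mul_Y_of_gt h⟩
  cases ε <;> cases δ
  · exact ⟨_, hne _ _, Y_mul_Y i j⟩
  · exact (hXY j i h.symm).symm
  · exact hXY i j h
  · rcases lt_or_gt_of_ne h with h | h
    · exact ⟨_, mul_ne_zero (Q i).ne_zero (hne _ _), X_mul_X_of_lt h⟩
    · exact SkewCommute.symm ⟨_, mul_ne_zero (Q j).ne_zero (hne _ _), X_mul_X_of_lt h⟩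

/-- The factors from `Γ` cancel between `Y l` and `X l`; only a possible `q_i` remains. -/
theorem X_mul_YX {i l : Fin n} (h : l ≠ i) :
    X Q Γ i * (Y Q Γ l * X Q Γ l) =
      (if i < l then (Q i : k) else 1) • (Y Q Γ l * X Q Γ l * X Q Γ i) := by
  rcases lt_or_gt_of_ne h with h | h
  · rw [if_neg h.not_gt, ← mul_assoc, X_mul_Y_of_gt h, smul_mul_assoc, mul_assoc, ← mul_smul_comm,
      ← X_mul_X_of_lt h, mul_assoc, one_smul]
  · rw [if_pos h, ← mul_assoc, X_mul_Y_of_lt h, smul_mul_assoc, mul_assoc, X_mul_X_of_lt h,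
      mul_smul_comm, smul_smul, mul_assoc]
    congr 1
    linear_combination (Q i : k) * hΓ l i

theorem YX_mul_Y {i l : Fin n} (h : l ≠ i) :
    Y Q Γ l * X Q Γ l * Y Q Γ i =
      (if i < l then (Q i : k) else 1) • (Y Q Γ i * (Y Q Γ l * X Q Γ l)) := by
  rcases lt_or_gt_of_ne h with h | h
  · rw [if_neg h.not_gt, mul_assoc, X_mul_Y_of_lt h, mul_smul_comm, ← mul_assoc, Y_mul_Y l i,
      smul_mul_assoc, smul_smul, hΓ, mul_assoc]
  · rw [if_pos h, mul_assoc, X_mul_Y_of_gt h, mul_smul_comm, ← mul_assoc, Y_mul_Y l i,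
      smul_mul_assoc, smul_smul, mul_assoc (Y Q Γ i)]
    congr 1
    linear_combination (Q i : k) * hΓ i l

theorem X_mul_Z (i : Fin n) (m : ℕ) :
    X Q Γ i * Z Q Γ m = (if (i : ℕ) < m then (Q i : k) else 1) • (Z Q Γ m * X Q Γ i) := by
  induction m with
  | zero => simp [Z_zero]
  | succ m ih =>
    by_cases hm : m < n
    · have h := Z_succ (Q := Q) (Γ := Γ) ⟨m, hm⟩
      simp only at h
      rw [h, mul_add, add_mul, ih, mul_smul_comm, smul_mul_assoc]
      rcases eq_or_ne (⟨m, hm⟩ : Fin n) i with rfl | hi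
      -- The inhomogeneous term in `x_i y_i = q_i y_i x_i + z_i` turns the scalar 1 for `z_i` into
      -- the scalar `q_i` for `z_{i+1}`.
      · simp only [lt_self_iff_false, Nat.lt_succ_self, if_true, if_false]
        rw [← mul_assoc, X_mul_Y_self, add_mul, smul_mul_assoc]
        module
      · rw [X_mul_YX hΓ hi]
        have h1 : i < (⟨m, hm⟩ : Fin n) ↔ (i : ℕ) < m := Iff.rfl
        have h2 : (i : ℕ) < m + 1 ↔ (i : ℕ) < m := by
          have : (i : ℕ) ≠ m := fun h => hi (Fin.ext h.symm)
          omega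
        simp only [h1, h2]
        module
    · rw [Z_succ_of_le (by omega), ih, if_pos (by omega), if_pos (by omega)]

theorem Z_mul_Y (i : Fin n) (m : ℕ) :
    Z Q Γ m * Y Q Γ i = (if (i : ℕ) < m then (Q i : k) else 1) • (Y Q Γ i * Z Q Γ m) := by
  induction m with
  | zero => simp [Z_zero]
  | succ m ih =>
    by_cases hm : m < n
    · have h := Z_succ (Q := Q) (Γ := Γ) ⟨m, hm⟩
      simp only at h
      rw [h, mul_add, add_mul, ih, mul_smul_comm, smul_mul_assoc]
      rcases eq_or_ne (⟨m, hm⟩ : Fin n) i with rfl | hi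
      · simp only [lt_self_iff_false, Nat.lt_succ_self, if_true, if_false]
        rw [mul_assoc, X_mul_Y_self, mul_add, mul_smul_comm]
        module
      · rw [YX_mul_Y hΓ hi]
        have h1 : i < (⟨m, hm⟩ : Fin n) ↔ (i : ℕ) < m := Iff.rfl
        have h2 : (i : ℕ) < m + 1 ↔ (i : ℕ) < m := by
          have : (i : ℕ) ≠ m := fun h => hi (Fin.ext h.symm)
          omega
        simp only [h1, h2]
        module
    · rw [Z_succ_of_le (by omega), ih, if_pos (by omega), if_pos (by omega)]

end

/-- The scalar by which the generator `G ε i` commutes with `Z m`. -/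
def zScalar (Q : Fin n → kˣ) (ε : Bool) (i : Fin n) (m : ℕ) : kˣ :=
  if (i : ℕ) < m then (if ε then Q i else (Q i)⁻¹) else 1

theorem G_mul_Z (hΓ : ∀ i j, Γ i j * Γ j i = 1) (ε : Bool) (i : Fin n) (m : ℕ) :
    G Q Γ ε i * Z Q Γ m = (zScalar Q ε i m : k) • (Z Q Γ m * G Q Γ ε i) := by
  cases ε
  · change Y Q Γ i * _ = _ • (_ * Y Q Γ i)
    rw [Z_mul_Y hΓ, smul_smul]
    simp only [zScalar, Bool.false_eq_true, if_false]
    split_ifs <;> simp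
  · change X Q Γ i * _ = _ • (_ * X Q Γ i)
    rw [X_mul_Z hΓ]
    simp only [zScalar, if_true]
    split_ifs <;> simp

theorem skewCommute_G_Z (hΓ : ∀ i j, Γ i j * Γ j i = 1) (ε : Bool) (i : Fin n) (m : ℕ) :
    SkewCommute k (G Q Γ ε i) (Z Q Γ m) := ⟨_, Units.ne_zero _, G_mul_Z hΓ ε i m⟩

theorem commute_Z (hΓ : ∀ i j, Γ i j * Γ j i = 1) (m m' : ℕ) :
    Commute (Z Q Γ m) (Z Q Γ m') := by
  refine Commute.add_left (Commute.one_left _) (Commute.sum_left _ _ _ fun l _ => ?_)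
  refine Commute.smul_left ?_ _
  have h1 := G_mul_Z (Q := Q) hΓ true l m'
  have h2 := G_mul_Z (Q := Q) hΓ false l m'
  change X Q Γ l * _ = _ • (_ * X Q Γ l) at h1
  change Y Q Γ l * _ = _ • (_ * Y Q Γ l) at h2
  rw [Commute, SemiconjBy, mul_assoc, h1, mul_smul_comm, ← mul_assoc, h2, smul_mul_assoc,
    smul_smul, mul_assoc]
  simp only [zScalar, Bool.false_eq_true, if_true, if_false]
  split_ifs <;> simp

/-- The coefficient in `G_mul_G_self`. -/
def selfScalar (Q : Fin n → kˣ) (ε : Bool) (i : Fin n) : kˣ := if ε then 1 else Q i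

/-- This eliminates mixed products of `x_i` and `y_i` in favour of the `z`'s; the two orders differ
only in the coefficient of `z_{i+1}`. -/
theorem G_mul_G_self (ε : Bool) (i : Fin n) :
    ((Q i : k) - 1) • (G Q Γ (!ε) i * G Q Γ ε i) =
      (selfScalar Q ε i : k) • Z Q Γ (i + 1) - Z Q Γ i := by
  rw [Z_succ]
  cases ε
  · change _ • (X Q Γ i * Y Q Γ i) = _
    rw [X_mul_Y_self]
    simp only [selfScalar, Bool.false_eq_true, if_false]
    module
  · change _ • (Y Q Γ i * X Q Γ i) = _
    simp only [selfScalar, if_true, Units.val_one]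
    module

end QWeyl

namespace AdmissibleSet

/-- The indices of the generators `G ε` of an admissible set. -/
def g {n : ℕ} (T : AdmissibleSet n) (ε : Bool) (i : ℕ) : Prop := if ε then T.x i else T.y i

theorem z_of_g {n : ℕ} (T : AdmissibleSet n) {ε : Bool} {i : ℕ} (h : T.g ε i) :
    T.z i ∧ T.z (i + 1) := by
  cases ε
  · exact T.z_of_y h
  · exact T.z_of_x h

theorem g_or_g_not {n : ℕ} (T : AdmissibleSet n) {ε : Bool} {i : ℕ} (h : T.z i)
    (h' : T.z (i + 1)) : T.g ε i ∨ T.g (!ε) i := by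
  have h1 := (T.x_or_y_iff i).2 ⟨h, h'⟩
  cases ε
  · exact h1.symm
  · exact h1

end AdmissibleSet

/-- The integer `m` or `-m`. -/
def signed (ε : Bool) (m : ℕ) : ℤ := if ε then m else -m

theorem exists_eq_signed (a : ℤ) : ∃ ε m, a = signed ε m := by
  obtain ⟨m, rfl | rfl⟩ := Int.eq_nat_or_neg a
  · exact ⟨true, m, rfl⟩
  · exact ⟨false, m, rfl⟩

@[simp] theorem signed_zero (ε : Bool) : signed ε 0 = 0 := by cases ε <;> simp [signed]

@[simp] theorem natAbs_signed (ε : Bool) (m : ℕ) : (signed ε m).natAbs = m := by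
  cases ε <;> simp [signed]

theorem signed_eq_signed_iff {ε δ : Bool} {m l : ℕ} :
    signed ε m = signed δ l ↔ m = l ∧ (ε = δ ∨ m = 0) := by
  cases ε <;> cases δ <;> simp [signed] <;> omega

namespace QWeyl

variable {k : Type*} [Field k] {n : ℕ} {Q : Fin n → kˣ} {Γ : Matrix (Fin n) (Fin n) k}

/-! ### Monomials -/

variable (Q Γ) in
/-- The factor of index `i` in a monomial. -/
def monFactor (a : Fin n → ℤ) (i : Fin n) : QWeyl Q Γ :=
  G Q Γ (decide (0 ≤ a i)) i ^ (a i).natAbs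

variable (Q Γ) in
/-- The monomial of degree `a` in the generators `x_i` and `y_i`. -/
def mon (a : Fin n → ℤ) : QWeyl Q Γ := ((List.finRange n).map (monFactor Q Γ a)).prod

variable (Q Γ) in
/-- The monomial `∏ z_{i+1} ^ c_i`. -/
def zmon (c : Fin n → ℕ) : QWeyl Q Γ :=
  ((List.finRange n).map fun i : Fin n => Z Q Γ (i + 1) ^ c i).prod

theorem monFactor_update_signed (a : Fin n → ℤ) (i : Fin n) (ε : Bool) (m : ℕ) :
    monFactor Q Γ (Function.update a i (signed ε m)) i = G Q Γ ε i ^ m := by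
  rw [monFactor, Function.update_self, natAbs_signed]
  cases m with
  | zero => simp
  | succ m =>
    have h : decide (0 ≤ signed ε (m + 1)) = ε := by
      cases ε
      · simpa [signed] using by omega
      · simpa [signed] using by omega
    rw [h]

theorem monFactor_update_zero (a : Fin n → ℤ) (i : Fin n) :
    monFactor Q Γ (Function.update a i 0) = Function.update (monFactor Q Γ a) i 1 := by
  ext j
  rcases eq_or_ne j i with rfl | h
  · simp [monFactor]
  · simp [monFactor, h]

theorem mon_zero : mon Q Γ 0 = 1 := by
  have : monFactor Q Γ (0 : Fin n → ℤ) = fun _ => 1 := by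
    ext i
    simp [monFactor]
  rw [mon, this]
  simp

theorem zmon_zero : zmon Q Γ 0 = 1 := by simp [zmon]

section

variable (hΓ : ∀ i j, Γ i j * Γ j i = 1)
include hΓ

/-- Distinct indices skew-commute, so reordering a monomial costs only a nonzero scalar, whose value
never matters. -/
theorem mon_update_signed (a : Fin n → ℤ) (i : Fin n) (ε : Bool) (m : ℕ) :
    ∃ κ : k, κ ≠ 0 ∧ mon Q Γ (Function.update a i (signed ε m)) =
      κ • (G Q Γ ε i ^ m * mon Q Γ (Function.update a i 0)) := by
  obtain ⟨κ, h0, h⟩ := SkewCommute.exists_list_prod_eq (k := k)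
    (f := monFactor Q Γ (Function.update a i (signed ε m))) (List.nodup_finRange n)
    (List.mem_finRange i) fun j hj =>
      ((skewCommute_G hΓ hj _ _).pow_left _).pow_right _
  refine ⟨κ, h0, h.trans ?_⟩
  rw [monFactor_update_signed, ← monFactor_update_zero, Function.update_idem, mon]

theorem skewCommute_G_mon (a : Fin n → ℤ) (i : Fin n) (ε : Bool) :
    SkewCommute k (G Q Γ ε i) (mon Q Γ (Function.update a i 0)) := by
  refine SkewCommute.list_prod_right fun j _ => ?_
  rcases eq_or_ne j i with rfl | h
  · simpa [monFactor] using SkewCommute.of_commute (Commute.one_right _)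
  · exact (skewCommute_G hΓ h.symm _ _).pow_right _

theorem G_mul_mon (a : Fin n → ℤ) (i : Fin n) (ε : Bool) (m : ℕ) :
    ∃ κ : k, κ ≠ 0 ∧ G Q Γ ε i * mon Q Γ (Function.update a i (signed ε m)) =
      κ • mon Q Γ (Function.update a i (signed ε (m + 1))) := by
  obtain ⟨κ, h0, h⟩ := mon_update_signed (Q := Q) hΓ a i ε m
  obtain ⟨κ', h0', h'⟩ := mon_update_signed (Q := Q) hΓ a i ε (m + 1)
  refine ⟨κ * κ'⁻¹, mul_ne_zero h0 (inv_ne_zero h0'), ?_⟩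
  rw [h, h', smul_smul, mul_assoc, inv_mul_cancel₀ h0', mul_one, mul_smul_comm, ← mul_assoc,
    ← pow_succ']

theorem mon_mul_G (a : Fin n → ℤ) (i : Fin n) (ε : Bool) (m : ℕ) :
    SkewCommute k (mon Q Γ (Function.update a i (signed ε m))) (G Q Γ ε i) := by
  obtain ⟨κ, h0, h⟩ := mon_update_signed (Q := Q) hΓ a i ε m
  obtain ⟨κ', h0', h'⟩ := ((SkewCommute.of_commute (k := k)
    (Commute.pow_right (Commute.refl (G Q Γ ε i)) m)).mul_right (skewCommute_G_mon hΓ a i ε)).symm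
  refine ⟨κ', h0', ?_⟩
  rw [h, smul_mul_assoc, h', mul_smul_comm, smul_comm]

theorem Z_mul_zmon (i : Fin n) (c : Fin n → ℕ) :
    Z Q Γ (i + 1) * zmon Q Γ c = zmon Q Γ (Function.update c i (c i + 1)) := by
  have key : ∀ l : List (Fin n), l.Nodup → i ∈ l →
      Z Q Γ (i + 1) * (l.map fun j : Fin n => Z Q Γ (j + 1) ^ c j).prod =
        (l.map fun j : Fin n => Z Q Γ (j + 1) ^ Function.update c i (c i + 1) j).prod := by
    intro l
    induction l with
    | nil => simp
    | cons j l ih =>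
      intro hl hi
      rw [List.nodup_cons] at hl
      simp only [List.map_cons, List.prod_cons]
      rcases eq_or_ne j i with rfl | hj
      · rw [← mul_assoc, ← pow_succ', Function.update_self]
        congr 2
        refine List.map_congr_left fun a ha => ?_
        rw [Function.update_of_ne]
        rintro rfl
        exact hl.1 ha
      · rw [← ih hl.2 (by simpa [hj.symm] using hi), Function.update_of_ne hj, ← mul_assoc,
          ← mul_assoc, ((commute_Z hΓ _ _).pow_right _).eq]
  exact key _ (List.nodup_finRange n) (List.mem_finRange i)

theorem commute_zmon_Z (m : ℕ) (c : Fin n → ℕ) : Commute (zmon Q Γ c) (Z Q Γ m) := by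
  refine Commute.list_prod_left _ _ fun a ha => ?_
  rw [List.mem_map] at ha
  obtain ⟨i, -, rfl⟩ := ha
  exact (commute_Z hΓ _ _).pow_left _

theorem G_mul_zmon (ε : Bool) (i : Fin n) (c : Fin n → ℕ) :
    G Q Γ ε i * zmon Q Γ c =
      (∏ j : Fin n, (zScalar Q ε i (j + 1) : k) ^ c j) • (zmon Q Γ c * G Q Γ ε i) := by
  have h1 : ∀ m p, G Q Γ ε i * Z Q Γ m ^ p =
      (zScalar Q ε i m : k) ^ p • (Z Q Γ m ^ p * G Q Γ ε i) := by
    intro m p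
    induction p with
    | zero => simp
    | succ p ih =>
      rw [pow_succ, ← mul_assoc, ih, smul_mul_assoc, mul_assoc, G_mul_Z hΓ, mul_smul_comm,
        smul_smul, mul_assoc, pow_succ]
  have key : ∀ l : List (Fin n), G Q Γ ε i * (l.map fun j : Fin n => Z Q Γ (j + 1) ^ c j).prod =
      (l.map fun j : Fin n => (zScalar Q ε i (j + 1) : k) ^ c j).prod •
        ((l.map fun j : Fin n => Z Q Γ (j + 1) ^ c j).prod * G Q Γ ε i) := by
    intro l
    induction l with
    | nil => simp
    | cons j l ih =>
      simp only [List.map_cons, List.prod_cons]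
      rw [← mul_assoc, h1, smul_mul_assoc, mul_assoc, ih, mul_smul_comm, smul_smul, mul_assoc]
  rw [zmon, key, ← List.ofFn_eq_map, List.prod_ofFn]

end

/-! ### Spanning modulo an ideal -/

/-- A two-sided ideal as a subspace. -/
def idealSubmodule (I : TwoSidedIdeal (QWeyl Q Γ)) : Submodule k (QWeyl Q Γ) where
  carrier := {a | a ∈ I}
  add_mem' := I.add_mem
  zero_mem' := I.zero_mem
  smul_mem' r a h := by
    rw [Algebra.smul_def]
    exact I.mul_mem_left _ _ h

theorem smul_mem_ideal {I : TwoSidedIdeal (QWeyl Q Γ)} (r : k) {a : QWeyl Q Γ} (h : a ∈ I) :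
    r • a ∈ I := (idealSubmodule I).smul_mem r h

theorem smul_mem_ideal_iff {I : TwoSidedIdeal (QWeyl Q Γ)} {r : k} (hr : r ≠ 0)
    {a : QWeyl Q Γ} : r • a ∈ I ↔ a ∈ I := (idealSubmodule I).smul_mem_iff hr

/-- The exponents of the `z`-monomials which do not involve elements of `T`. -/
def ZAllowed (T : AdmissibleSet n) (c : Fin n → ℕ) : Prop :=
  ∀ i : Fin n, T.z (i + 1) → c i = 0

/-- The degrees of the monomials which do not involve elements of `T`. -/
def Allowed (T : AdmissibleSet n) (a : Fin n → ℤ) : Prop :=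
  ∀ i ε m, a i = signed ε (m + 1) → ¬ T.g ε i

/-- The ideal contains the elements indexed by the admissible set. -/
structure Contains (I : TwoSidedIdeal (QWeyl Q Γ)) (T : AdmissibleSet n) : Prop where
  z_mem : ∀ m, T.z m → Z Q Γ m ∈ I
  g_mem : ∀ (i : Fin n) ε, T.g ε i → G Q Γ ε i ∈ I

theorem Allowed.update_signed {T : AdmissibleSet n} {a : Fin n → ℤ} (h : Allowed T a) {i : Fin n}
    {ε : Bool} {m : ℕ} (hi : m ≠ 0 → ¬ T.g ε i) :
    Allowed T (Function.update a i (signed ε m)) := by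
  intro j δ l hj
  rcases eq_or_ne j i with rfl | hji
  · rw [Function.update_self, signed_eq_signed_iff] at hj
    obtain ⟨rfl, hj⟩ := hj
    rw [← hj.resolve_right (Nat.succ_ne_zero l)]
    exact hi (Nat.succ_ne_zero l)
  · rw [Function.update_of_ne hji] at hj
    exact h j δ l hj

theorem ZAllowed.update {T : AdmissibleSet n} {c : Fin n → ℕ} (h : ZAllowed T c) {i : Fin n}
    (hi : ¬ T.z (i + 1)) (m : ℕ) : ZAllowed T (Function.update c i m) := by
  intro j hj
  rcases eq_or_ne j i with rfl | hji
  · exact absurd hj hi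
  · rw [Function.update_of_ne hji]
    exact h j hj

variable (Q Γ) in
/-- The allowed monomials. -/
def allowedMon (T : AdmissibleSet n) (p : {c // ZAllowed T c} × {a // Allowed T a}) :
    QWeyl Q Γ := zmon Q Γ p.1 * mon Q Γ p.2

section

variable (hΓ : ∀ i j, Γ i j * Γ j i = 1) {I : TwoSidedIdeal (QWeyl Q Γ)} {T : AdmissibleSet n}
  (hT : Contains I T)
include hΓ hT

theorem zmon_mul_Z_mul_mon_mem {c : Fin n → ℕ} {a : Fin n → ℤ} (hc : ZAllowed T c)
    (ha : Allowed T a) {m : ℕ} (hm : m ≤ n) :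
    zmon Q Γ c * (Z Q Γ m * mon Q Γ a) ∈
      Submodule.span k (Set.range (allowedMon Q Γ T)) ⊔ idealSubmodule I := by
  by_cases hz : T.z m
  · exact Submodule.mem_sup_right (I.mul_mem_left _ _ (I.mul_mem_right _ _ (hT.z_mem m hz)))
  · refine Submodule.mem_sup_left (Submodule.subset_span ?_)
    cases m with
    | zero => exact ⟨(⟨c, hc⟩, ⟨a, ha⟩), by rw [Z_zero, one_mul, allowedMon]⟩
    | succ m =>
      refine ⟨(⟨_, hc.update (i := ⟨m, hm⟩) hz (c ⟨m, hm⟩ + 1)⟩, ⟨a, ha⟩), ?_⟩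
      rw [allowedMon, ← Z_mul_zmon hΓ, ← (commute_zmon_Z hΓ _ c).eq, mul_assoc]

/-- If `a i` has the sign of the new generator, its size grows by one. If it has the opposite sign,
the meeting pair is replaced by `z_{i+1}` and `z_i`, after division by `q_i - 1`. -/
theorem zmon_mul_G_mul_mon_mem (hQ1 : ∀ i, (Q i : k) - 1 ≠ 0) {c : Fin n → ℕ} {a : Fin n → ℤ}
    (hc : ZAllowed T c) (ha : Allowed T a) (ε : Bool) (i : Fin n) :
    zmon Q Γ c * (G Q Γ ε i * mon Q Γ a) ∈
      Submodule.span k (Set.range (allowedMon Q Γ T)) ⊔ idealSubmodule I := by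
  obtain ⟨δ, m, hδ⟩ := exists_eq_signed (a i)
  by_cases h : m = 0 ∨ δ = ε
  · have h1 : a i = signed ε m := by
      rw [hδ, signed_eq_signed_iff]
      exact ⟨rfl, h.symm⟩
    by_cases hg : T.g ε i
    · exact Submodule.mem_sup_right (I.mul_mem_left _ _ (I.mul_mem_right _ _ (hT.g_mem i ε hg)))
    · obtain ⟨κ, -, hκ⟩ := G_mul_mon (Q := Q) hΓ a i ε m
      rw [← h1, Function.update_eq_self] at hκ
      rw [hκ, mul_smul_comm]
      exact Submodule.smul_mem _ _ (Submodule.mem_sup_left (Submodule.subset_span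
        ⟨(⟨c, hc⟩, ⟨_, ha.update_signed fun _ => hg⟩), rfl⟩))
  · obtain ⟨hm, hne⟩ := not_or.1 h
    obtain ⟨m, rfl⟩ := Nat.exists_eq_succ_of_ne_zero hm
    obtain rfl : ε = !δ := by cases ε <;> cases δ <;> simp_all
    obtain ⟨κ, -, hκ⟩ := mon_update_signed (Q := Q) hΓ a i δ (m + 1)
    obtain ⟨κ', h0', hκ'⟩ := mon_update_signed (Q := Q) hΓ a i δ m
    rw [← hδ, Function.update_eq_self] at hκ
    have h2 : ((Q i : k) - 1) • (G Q Γ (!δ) i * mon Q Γ a) =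
        (κ * κ'⁻¹) • (((selfScalar Q δ i : k) • Z Q Γ (i + 1) - Z Q Γ i) *
          mon Q Γ (Function.update a i (signed δ m))) := by
      rw [hκ, hκ', mul_smul_comm, mul_smul_comm, smul_smul, smul_smul, mul_assoc κ,
        inv_mul_cancel₀ h0', mul_one, ← G_mul_G_self, mul_comm _ κ, smul_mul_assoc, smul_smul,
        pow_succ']
      simp only [mul_assoc]
    have ha' : Allowed T (Function.update a i (signed δ m)) :=
      ha.update_signed fun _ => ha i δ m hδ
    rw [← Submodule.smul_mem_iff _ (hQ1 i), ← mul_smul_comm, h2, mul_smul_comm, sub_mul,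
      smul_mul_assoc, mul_sub, mul_smul_comm]
    exact Submodule.smul_mem _ _ (Submodule.sub_mem _
      (Submodule.smul_mem _ _ (zmon_mul_Z_mul_mon_mem hΓ hT hc ha' i.2))
      (zmon_mul_Z_mul_mon_mem hΓ hT hc ha' i.2.le))

/-- The allowed monomials span modulo the ideal. -/
theorem mem_span_allowedMon_sup (hQ1 : ∀ i, (Q i : k) - 1 ≠ 0) (r : QWeyl Q Γ) :
    r ∈ Submodule.span k (Set.range (allowedMon Q Γ T)) ⊔ idealSubmodule I := by
  set N := Submodule.span k (Set.range (allowedMon Q Γ T)) ⊔ idealSubmodule I with hN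
  -- It suffices that N contains 1 and is stable under left multiplication by generators.
  have key : ∀ r : QWeyl Q Γ, ∀ s ∈ N, r * s ∈ N := by
    intro r
    induction r using induction_on with
    | smul_one r =>
      intro s hs
      rw [smul_mul_assoc, one_mul]
      exact N.smul_mem r hs
    | gen ε i =>
      have h1 : N ≤ N.comap (LinearMap.mulLeft k (G Q Γ ε i)) := by
        refine sup_le (Submodule.span_le.2 ?_) fun s hs =>
          Submodule.mem_sup_right (I.mul_mem_left _ _ hs)
        rintro _ ⟨⟨⟨c, hc⟩, a, ha⟩, rfl⟩
        rw [SetLike.mem_coe, Submodule.mem_comap, LinearMap.mulLeft_apply, allowedMon, ← mul_assoc,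
          G_mul_zmon hΓ, smul_mul_assoc, mul_assoc]
        exact N.smul_mem _ (zmon_mul_G_mul_mon_mem hΓ hT hQ1 hc ha ε i)
      exact fun s hs => h1 hs
    | add a b ha hb =>
      intro s hs
      rw [add_mul]
      exact N.add_mem (ha s hs) (hb s hs)
    | mul a b ha hb =>
      intro s hs
      rw [mul_assoc]
      exact ha _ (hb s hs)
  rw [← mul_one r]
  refine key r 1 (Submodule.mem_sup_left (Submodule.subset_span
    ⟨(⟨0, fun _ _ => rfl⟩, ⟨0, fun i ε m h => ?_⟩), by simp [allowedMon, zmon_zero, mon_zero]⟩))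
  rw [Pi.zero_apply, ← signed_zero ε, signed_eq_signed_iff] at h
  omega

end

end QWeyl

/-- Primeness is stated for ideals, so `b` is put in the ideal J of all `v` with `a R v ⊆ P`, and
`a` in the ideal I of all `u` with `u R J ⊆ P`. -/
theorem TwoSidedIdeal.IsPrimeIdeal.mem_or_mem {R : Type*} [Ring R] {P : TwoSidedIdeal R}
    (hP : P.IsPrimeIdeal) {a b : R} (h : ∀ r, a * r * b ∈ P) : a ∈ P ∨ b ∈ P := by
  let J : TwoSidedIdeal R := TwoSidedIdeal.mk' {v | ∀ r, a * r * v ∈ P}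
    (fun r => by simp)
    (fun {x y} hx hy r => by simpa only [mul_add] using P.add_mem (hx r) (hy r))
    (fun {x} hx r => by simpa only [mul_neg] using P.neg_mem (hx r))
    (fun {x y} hy r => by simpa only [mul_assoc] using hy (r * x))
    (fun {x y} hx r => by simpa only [mul_assoc] using P.mul_mem_right _ y (hx r))
  have hJ : ∀ v, v ∈ J ↔ ∀ r, a * r * v ∈ P := fun v => TwoSidedIdeal.mem_mk' ..
  let I : TwoSidedIdeal R := TwoSidedIdeal.mk' {u | ∀ r, ∀ v ∈ J, u * r * v ∈ P}
    (fun r v _ => by simp)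
    (fun {x y} hx hy r v hv => by simpa only [add_mul] using P.add_mem (hx r v hv) (hy r v hv))
    (fun {x} hx r v hv => by simpa only [neg_mul] using P.neg_mem (hx r v hv))
    (fun {x y} hy r v hv => by simpa only [mul_assoc] using P.mul_mem_left x _ (hy r v hv))
    (fun {x y} hx r v hv => by simpa only [mul_assoc] using hx (y * r) v hv)
  have hI : ∀ u, u ∈ I ↔ ∀ r, ∀ v ∈ J, u * r * v ∈ P := fun u => TwoSidedIdeal.mem_mk' ..
  rcases hP.2 I J (fun u hu v hv => by simpa using (hI u).1 hu 1 v hv) with h' | h'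
  · exact Or.inl (h' ((hI a).2 fun r v hv => (hJ v).1 hv r))
  · exact Or.inr (h' ((hJ b).2 h))

namespace QWeyl

variable {k : Type*} [Field k] {n : ℕ} {Q : Fin n → kˣ} {Γ : Matrix (Fin n) (Fin n) k}

theorem smul_sub_smul_eq (r t : k) (v : QWeyl Q Γ) : r • v - t • v = (r - t) • v :=
  (sub_smul r t v).symm

/-! ### Cancellation modulo a prime ideal -/

/-- Modulo P every `g r` has the form `r' g`, hence `g R b ⊆ P`. The scalars `κ` may vanish. -/
theorem mem_of_mul_mem {P : TwoSidedIdeal (QWeyl Q Γ)} (hP : P.IsPrimeIdeal) {g : QWeyl Q Γ}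
    (hg : ∀ ε i, ∃ κ : k, g * G Q Γ ε i - κ • (G Q Γ ε i * g) ∈ P) (hgP : g ∉ P)
    {b : QWeyl Q Γ} (h : g * b ∈ P) : b ∈ P := by
  have key : ∀ r : QWeyl Q Γ, ∃ r', g * r - r' * g ∈ P := by
    intro r
    induction r using induction_on with
    | smul_one r => exact ⟨r • 1, by simp⟩
    | gen ε i =>
      obtain ⟨κ, h⟩ := hg ε i
      exact ⟨κ • G Q Γ ε i, by rwa [smul_mul_assoc]⟩
    | add a b ha hb =>
      obtain ⟨a', ha⟩ := ha
      obtain ⟨b', hb⟩ := hb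
      refine ⟨a' + b', ?_⟩
      have := P.add_mem ha hb
      rwa [sub_add_sub_comm, ← mul_add, ← add_mul] at this
    | mul a b ha hb =>
      obtain ⟨a', ha⟩ := ha
      obtain ⟨b', hb⟩ := hb
      refine ⟨a' * b', ?_⟩
      have := P.add_mem (P.mul_mem_right _ b ha) (P.mul_mem_left a' _ hb)
      have h1 : (g * a - a' * g) * b + a' * (g * b - b' * g) = g * (a * b) - a' * b' * g := by
        simp only [sub_mul, mul_sub, mul_assoc]
        abel
      rwa [h1] at this
  refine (hP.mem_or_mem fun r => ?_).resolve_left hgP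
  obtain ⟨r', hr⟩ := key r
  have := P.add_mem (P.mul_mem_right _ b hr) (P.mul_mem_left r' _ h)
  have h1 : (g * r - r' * g) * b + r' * (g * b) = g * r * b := by
    simp only [sub_mul, mul_assoc]
    abel
  rwa [h1] at this

theorem mem_of_Z_mul_mem (hΓ : ∀ i j, Γ i j * Γ j i = 1) {P : TwoSidedIdeal (QWeyl Q Γ)}
    (hP : P.IsPrimeIdeal) {m : ℕ} (hm : Z Q Γ m ∉ P) {b : QWeyl Q Γ} (h : Z Q Γ m * b ∈ P) :
    b ∈ P := by
  refine mem_of_mul_mem hP (fun ε i => ?_) hm h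
  obtain ⟨κ, -, hκ⟩ := (skewCommute_G_Z hΓ ε i m).symm
  exact ⟨κ, by rw [hκ, sub_self]; exact P.zero_mem⟩

theorem mem_of_G_mul_mem (hΓ : ∀ i j, Γ i j * Γ j i = 1) {P : TwoSidedIdeal (QWeyl Q Γ)}
    (hP : P.IsPrimeIdeal) {ε : Bool} {i : Fin n} (hi : G Q Γ ε i ∉ P)
    (hi' : G Q Γ ε i * G Q Γ (!ε) i ∈ P) {b : QWeyl Q Γ} (h : G Q Γ ε i * b ∈ P) : b ∈ P := by
  refine mem_of_mul_mem hP (fun δ j => ?_) hi h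
  rcases eq_or_ne i j with rfl | hj
  · by_cases hδ : δ = ε
    · subst hδ
      exact ⟨1, by simp⟩
    · obtain rfl : δ = !ε := by cases ε <;> cases δ <;> simp_all
      -- Here `κ = 0`, as the product of the two generators already lies in P.
      exact ⟨0, by simp [hi']⟩
  · obtain ⟨κ, -, hκ⟩ := skewCommute_G (Q := Q) hΓ hj ε δ
    exact ⟨κ, by rw [hκ, sub_self]; exact P.zero_mem⟩

theorem mem_of_zmon_mul_mem (hΓ : ∀ i j, Γ i j * Γ j i = 1) {P : TwoSidedIdeal (QWeyl Q Γ)}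
    (hP : P.IsPrimeIdeal) {c : Fin n → ℕ} (hc : ∀ i : Fin n, Z Q Γ (i + 1) ∈ P → c i = 0)
    {b : QWeyl Q Γ} (h : zmon Q Γ c * b ∈ P) : b ∈ P := by
  have h1 : ∀ (i : Fin n) b, Z Q Γ (i + 1) ^ c i * b ∈ P → b ∈ P := by
    intro i
    by_cases hi : Z Q Γ (i + 1) ∈ P
    · simp [hc i hi]
    · generalize c i = p
      induction p with
      | zero => simp
      | succ p ih =>
        intro b hb
        rw [pow_succ, mul_assoc] at hb
        exact mem_of_Z_mul_mem hΓ hP hi (ih _ hb)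
  have key : ∀ (l : List (Fin n)) b,
      (l.map fun i : Fin n => Z Q Γ (i + 1) ^ c i).prod * b ∈ P → b ∈ P := by
    intro l
    induction l with
    | nil => simp
    | cons i l ih =>
      intro b hb
      rw [List.map_cons, List.prod_cons, mul_assoc] at hb
      exact ih b (h1 i _ hb)
  exact key _ b h

/-- The admissible set of a prime ideal. -/
def toAdmissible (hΓ : ∀ i j, Γ i j * Γ j i = 1) {P : TwoSidedIdeal (QWeyl Q Γ)}
    (hQ1 : ∀ i : Fin n, (Q i : k) - 1 ≠ 0) (hP : P.IsPrimeIdeal) : AdmissibleSet n where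
  z m := m ≤ n ∧ Z Q Γ m ∈ P
  x i := ∃ h : i < n, X Q Γ ⟨i, h⟩ ∈ P
  y i := ∃ h : i < n, Y Q Γ ⟨i, h⟩ ∈ P
  not_z_zero h := by
    rw [Z_zero] at h
    refine hP.1 (top_unique fun a _ => ?_)
    simpa using P.mul_mem_left a 1 h.2
  x_or_y_iff i := by
    by_cases hi : i < n
    swap
    · simp only [hi, IsEmpty.exists_iff, or_self, false_iff, not_and]
      intro _ h
      omega
    have h1 := X_mul_Y_self (Q := Q) (Γ := Γ) ⟨i, hi⟩
    have h2 := Z_succ (Q := Q) (Γ := Γ) ⟨i, hi⟩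
    simp only [hi, exists_true_left]
    simp only at h1 h2
    constructor
    · intro h
      have hxy : X Q Γ ⟨i, hi⟩ * Y Q Γ ⟨i, hi⟩ ∈ P ∧ Y Q Γ ⟨i, hi⟩ * X Q Γ ⟨i, hi⟩ ∈ P := by
        rcases h with h | h
        · exact ⟨P.mul_mem_right _ _ h, P.mul_mem_left _ _ h⟩
        · exact ⟨P.mul_mem_left _ _ h, P.mul_mem_right _ _ h⟩
      have hz : Z Q Γ i ∈ P := by
        have := P.sub_mem hxy.1 (smul_mem_ideal (Q ⟨i, hi⟩ : k) hxy.2)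
        rwa [h1, add_sub_cancel_left] at this
      refine ⟨⟨hi.le, hz⟩, hi, ?_⟩
      rw [h2]
      exact P.add_mem hz (smul_mem_ideal _ hxy.2)
    · rintro ⟨⟨-, hz⟩, -, hz'⟩
      have hyx : Y Q Γ ⟨i, hi⟩ * X Q Γ ⟨i, hi⟩ ∈ P := by
        rw [← smul_mem_ideal_iff (hQ1 ⟨i, hi⟩)]
        have := P.sub_mem hz' hz
        rwa [h2, add_sub_cancel_left] at this
      have hxy : X Q Γ ⟨i, hi⟩ * Y Q Γ ⟨i, hi⟩ ∈ P := by
        rw [h1]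
        exact P.add_mem (smul_mem_ideal _ hyx) hz
      by_contra h
      obtain ⟨hx, hy⟩ := not_or.1 h
      -- As `x_i y_i` lies in P and `x_i` does not, `x_i` can be cancelled.
      exact hy (mem_of_G_mul_mem hΓ hP (ε := true) hx hxy hxy)
  le_of_z i h := h.1

theorem toAdmissible_g (hΓ : ∀ i j, Γ i j * Γ j i = 1) {P : TwoSidedIdeal (QWeyl Q Γ)}
    (hQ1 : ∀ i : Fin n, (Q i : k) - 1 ≠ 0) (hP : P.IsPrimeIdeal) (ε : Bool) (i : Fin n) :
    (toAdmissible hΓ hQ1 hP).g ε i ↔ G Q Γ ε i ∈ P := by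
  cases ε <;> simp [AdmissibleSet.g, toAdmissible, G]

/-! ### Independence of the allowed monomials modulo a prime -/

section

variable (hΓ : ∀ i j, Γ i j * Γ j i = 1) {P : TwoSidedIdeal (QWeyl Q Γ)}
  (hQ : ∀ i, ∀ m : ℕ, 0 < m → Q i ^ m ≠ 1) (hQ1 : ∀ i : Fin n, (Q i : k) - 1 ≠ 0) (hP : P.IsPrimeIdeal)
include hΓ

theorem G_pow_mul_Z (ε : Bool) (i : Fin n) (p m : ℕ) :
    G Q Γ ε i ^ p * Z Q Γ m = (zScalar Q ε i m : k) ^ p • (Z Q Γ m * G Q Γ ε i ^ p) := by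
  induction p with
  | zero => simp
  | succ p ih =>
    rw [pow_succ, mul_assoc, G_mul_Z hΓ, mul_smul_comm, ← mul_assoc, ih, smul_mul_assoc, smul_smul,
      mul_assoc, pow_succ' (zScalar Q ε i m : k)]

include hQ hQ1 hP

/-- If the opposite generator lies in P, then `G ε i` can be cancelled. Otherwise multiply by the
opposite generator on the left and on the right: this gives two combinations of `z_{i+1} G^m M` and
`z_i G^m M` in P, with equal coefficients at `z_i` and different ones at `z_{i+1}`. Both products
thus lie in P, and one of the `z`'s cancels. -/
theorem pow_mul_mon_mem (a : Fin n → ℤ) (i : Fin n) (ε : Bool) (m : ℕ) (hε : G Q Γ ε i ∉ P)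
    (h : G Q Γ ε i ^ (m + 1) * mon Q Γ (Function.update a i 0) ∈ P) :
    G Q Γ ε i ^ m * mon Q Γ (Function.update a i 0) ∈ P := by
  set M := mon Q Γ (Function.update a i 0)
  by_cases hε' : G Q Γ (!ε) i ∈ P
  · refine mem_of_G_mul_mem hΓ hP hε (P.mul_mem_left _ _ hε') ?_
    rwa [← mul_assoc, ← pow_succ']
  · have h1 : (selfScalar Q ε i : k) • (Z Q Γ (i + 1) * (G Q Γ ε i ^ m * M)) -
        Z Q Γ i * (G Q Γ ε i ^ m * M) ∈ P := by
      have := smul_mem_ideal ((Q i : k) - 1) (P.mul_mem_left (G Q Γ (!ε) i) _ h)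
      rwa [pow_succ', mul_assoc, ← mul_assoc, ← smul_mul_assoc, G_mul_G_self, sub_mul,
        smul_mul_assoc] at this
    obtain ⟨κ, h0, hκ⟩ := skewCommute_G_mon (Q := Q) hΓ a i (!ε)
    have h2 : ((selfScalar Q (!ε) i : k) * (zScalar Q ε i (i + 1) : k) ^ m) •
        (Z Q Γ (i + 1) * (G Q Γ ε i ^ m * M)) - Z Q Γ i * (G Q Γ ε i ^ m * M) ∈ P := by
      have := smul_mem_ideal (((Q i : k) - 1) * κ) (P.mul_mem_right _ (G Q Γ (!ε) i) h)
      rw [mul_smul, mul_assoc, ← mul_smul_comm κ, ← hκ, pow_succ, mul_assoc, ← mul_smul_comm,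
        ← mul_assoc (G Q Γ ε i), ← smul_mul_assoc] at this
      have h3 := G_mul_G_self (Q := Q) (Γ := Γ) (!ε) i
      rw [Bool.not_not] at h3
      rw [h3, ← mul_assoc, mul_sub, mul_smul_comm, G_pow_mul_Z hΓ, G_pow_mul_Z hΓ, smul_smul] at this
      have h4 : zScalar Q ε i i = 1 := by simp [zScalar]
      rw [h4, Units.val_one, one_pow, one_smul, sub_mul, smul_mul_assoc, mul_assoc, mul_assoc]
        at this
      exact this
    -- The two coefficients are `1` and `q_i^(m+1)` for `x`, and `q_i` and `q_i^(-m)` for `y`.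
    have hne : (selfScalar Q ε i : k) - (selfScalar Q (!ε) i : k) *
        (zScalar Q ε i (i + 1) : k) ^ m ≠ 0 := by
      rw [sub_ne_zero]
      intro he
      rw [← Units.val_pow_eq_pow_val, ← Units.val_mul, Units.val_inj] at he
      refine hQ i (m + 1) (Nat.succ_pos m) ?_
      cases ε
      · simp only [selfScalar, zScalar, Bool.false_eq_true, if_false, Bool.not_false, if_true,
          one_mul, Nat.lt_succ_self, inv_pow] at he
        rw [pow_succ]
        nth_rewrite 2 [he]
        exact mul_inv_cancel _
      · simp only [selfScalar, zScalar, Bool.false_eq_true, if_false, Bool.not_true, if_true,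
          Nat.lt_succ_self] at he
        rw [pow_succ', ← he]
    have h5 : Z Q Γ (i + 1) * (G Q Γ ε i ^ m * M) ∈ P := by
      have := P.sub_mem h1 h2
      rw [sub_sub_sub_cancel_right] at this
      rw [smul_sub_smul_eq] at this
      exact (smul_mem_ideal_iff hne).1 this
    have h6 : Z Q Γ i * (G Q Γ ε i ^ m * M) ∈ P := by
      have := P.sub_mem (smul_mem_ideal (selfScalar Q ε i : k) h5) h1
      rwa [sub_sub_cancel] at this
    -- Not both of `z_i`, `z_{i+1}` are in P, since neither `x_i` nor `y_i` is.
    by_cases hz : Z Q Γ i ∈ P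
    · by_cases hz' : Z Q Γ (i + 1) ∈ P
      · rcases (toAdmissible hΓ hQ1 hP).g_or_g_not (ε := ε) (i := i) ⟨i.2.le, hz⟩ ⟨i.2, hz'⟩
          with h7 | h7
        · exact absurd ((toAdmissible_g hΓ hQ1 hP ε i).1 h7) hε
        · exact absurd ((toAdmissible_g hΓ hQ1 hP (!ε) i).1 h7) hε'
      · exact mem_of_Z_mul_mem hΓ hP hz' h5
    · exact mem_of_Z_mul_mem hΓ hP hz h6

/-- Descent on the total degree: `pow_mul_mon_mem` lowers one exponent at a time, until 1 would lie
in P. -/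
theorem mon_notMem {a : Fin n → ℤ} (ha : Allowed (toAdmissible hΓ hQ1 hP) a) :
    mon Q Γ a ∉ P := by
  induction hN : ∑ i, (a i).natAbs using Nat.strong_induction_on generalizing a with
  | h N ih =>
    intro hmem
    by_cases h0 : a = 0
    · rw [h0, mon_zero] at hmem
      refine hP.1 (top_unique fun b _ => ?_)
      simpa using P.mul_mem_left b 1 hmem
    · obtain ⟨i, hi⟩ := Function.ne_iff.1 h0
      obtain ⟨ε, m, hm⟩ := exists_eq_signed (a i)
      obtain ⟨m, rfl⟩ : ∃ m', m = m' + 1 := by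
        refine Nat.exists_eq_succ_of_ne_zero ?_
        rintro rfl
        exact hi (by simpa using hm)
      obtain ⟨κ, hκ0, hκ⟩ := mon_update_signed (Q := Q) hΓ a i ε (m + 1)
      obtain ⟨κ', hκ0', hκ'⟩ := mon_update_signed (Q := Q) hΓ a i ε m
      have hg : ¬ (toAdmissible hΓ hQ1 hP).g ε i := ha i ε m hm
      rw [← hm, Function.update_eq_self] at hκ
      rw [hκ, smul_mem_ideal_iff hκ0] at hmem
      refine ih _ ?_ (ha.update_signed (m := m) fun _ => hg) rfl ?_
      · rw [← hN]
        refine Finset.sum_lt_sum (fun j _ => ?_) ⟨i, Finset.mem_univ i, ?_⟩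
        · rcases eq_or_ne j i with rfl | hj
          · rw [Function.update_self, hm, natAbs_signed, natAbs_signed]
            omega
          · rw [Function.update_of_ne hj]
        · rw [Function.update_self, hm, natAbs_signed, natAbs_signed]
          omega
      · rw [hκ', smul_mem_ideal_iff hκ0']
        exact pow_mul_mon_mem hΓ hQ hQ1 hP a i ε m
          (fun h => hg ((toAdmissible_g hΓ hQ1 hP ε i).2 h)) hmem

theorem zmon_mul_mon_notMem {c : Fin n → ℕ} {a : Fin n → ℤ}
    (hc : ZAllowed (toAdmissible hΓ hQ1 hP) c) (ha : Allowed (toAdmissible hΓ hQ1 hP) a) :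
    zmon Q Γ c * mon Q Γ a ∉ P := fun h =>
  mon_notMem hΓ hQ hQ1 hP ha
    (mem_of_zmon_mul_mem hΓ hP (fun i hi => hc i ⟨i.2, hi⟩) h)

omit hQ1 hP hΓ in
/-- Commutation with a suitable generator separates two allowed `z`-monomials. -/
theorem exists_separating {T : AdmissibleSet n} {c c' : Fin n → ℕ} (hc : ZAllowed T c)
    (hc' : ZAllowed T c') (h : c ≠ c') :
    ∃ j : Fin n, (∀ ε, ¬ T.g ε j) ∧ ∀ ε, (∏ i : Fin n, (zScalar Q ε j (i + 1) : k) ^ c i) ≠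
      ∏ i : Fin n, (zScalar Q ε j (i + 1) : k) ^ c' i := by
  obtain ⟨j₀, hj₀⟩ := Function.ne_iff.1 h
  -- At the largest index `j` of disagreement, the factors with `i < j` are trivial and those with
  -- `i > j` agree, so only powers of `q_j` with exponents `c j` and `c' j`, up to a common sign,
  -- are compared.
  obtain ⟨j, hj, hmax⟩ := (Finset.univ.filter fun i => c i ≠ c' i).exists_max_image id
    ⟨j₀, by simpa using hj₀⟩
  replace hj : c j ≠ c' j := by simpa using hj
  replace hmax : ∀ i, j < i → c i = c' i := fun i hi => by
    by_contra hne
    exact absurd (hmax i (by simpa using hne)) (not_le_of_gt hi)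
  refine ⟨j, fun ε hg => ?_, fun ε he => ?_⟩
  · have hz := (T.z_of_g hg).2
    exact hj ((hc j hz).trans (hc' j hz).symm)
  · have h1 : ∀ i ∈ Finset.univ.erase j, (zScalar Q ε j (i + 1) : k) ^ c i =
        (zScalar Q ε j (i + 1) : k) ^ c' i := by
      intro i hi
      rcases lt_or_gt_of_ne (Finset.ne_of_mem_erase hi) with h2 | h2
      · have h3 : ¬ ((j : ℕ) < i + 1) := by
          have : (i : ℕ) < j := h2
          omega
        simp [zScalar, h3]
      · rw [hmax i h2]
    rw [← Finset.mul_prod_erase _ _ (Finset.mem_univ j), Finset.prod_congr rfl h1,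
      ← Finset.mul_prod_erase _ _ (Finset.mem_univ j)] at he
    have h2 := mul_right_cancel₀ (Finset.prod_ne_zero_iff.2 fun i _ =>
      pow_ne_zero _ (Units.ne_zero _)) he
    rw [← Units.val_pow_eq_pow_val, ← Units.val_pow_eq_pow_val, Units.val_inj] at h2
    have h3 : ¬ IsOfFinOrder (Q j) := by
      rw [isOfFinOrder_iff_pow_eq_one]
      rintro ⟨m, hm, h3⟩
      exact hQ j m hm h3
    refine hj (injective_pow_iff_not_isOfFinOrder.2 h3 ?_)
    cases ε
    · simpa [zScalar] using h2
    · simpa [zScalar] using h2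

/-- A skew commutator with the separating generator removes the term of `c₀` and keeps a nonzero
multiple of the coefficient of `c`. It also shifts the degree, so `a` varies in the induction. -/
theorem coeff_eq_zero (s : Finset {c // ZAllowed (toAdmissible hΓ hQ1 hP) c}) :
    ∀ a, Allowed (toAdmissible hΓ hQ1 hP) a →
    ∀ f : {c // ZAllowed (toAdmissible hΓ hQ1 hP) c} → k,
      ∑ c ∈ s, f c • (zmon Q Γ c * mon Q Γ a) ∈ P → ∀ c ∈ s, f c = 0 := by
  classical
  induction s using Finset.induction with
  | empty => simp
  | insert c₀ s hc₀ ih =>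
    intro a ha f hf
    have hs : ∀ c ∈ s, f c = 0 := by
      intro c hc
      obtain ⟨j, hj, hsep⟩ := exists_separating (Q := Q) hQ c.2 c₀.2
        (fun h => hc₀ (Subtype.ext h ▸ hc))
      -- Taking the sign of `a j` makes multiplication by the generator raise its exponent, without
      -- producing new `z`'s.
      obtain ⟨ε, m, hm⟩ := exists_eq_signed (a j)
      obtain ⟨κ, h0, hκ⟩ := mon_mul_G (Q := Q) hΓ a j ε m
      obtain ⟨κ', h0', hκ'⟩ := G_mul_mon (Q := Q) hΓ a j ε m
      rw [← hm, Function.update_eq_self] at hκ hκ'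
      set a' := Function.update a j (signed ε (m + 1)) with ha'
      set lam : (Fin n → ℕ) → k := fun c => ∏ i : Fin n, (zScalar Q ε j (i + 1) : k) ^ c i with hlam
      have hterm : ∀ c : {c // ZAllowed (toAdmissible hΓ hQ1 hP) c},
          κ • (G Q Γ ε j * (f c • (zmon Q Γ c * mon Q Γ a))) -
            lam c₀ • ((f c • (zmon Q Γ c * mon Q Γ a)) * G Q Γ ε j) =
          (f c * (κ * κ' * (lam c - lam c₀))) • (zmon Q Γ c * mon Q Γ a') := by
        intro c
        rw [mul_smul_comm, ← mul_assoc, G_mul_zmon hΓ, smul_mul_assoc, smul_mul_assoc, mul_assoc,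
          mul_assoc, hκ, hκ', mul_smul_comm, mul_smul_comm, mul_smul_comm]
        simp only [smul_smul]
        rw [smul_sub_smul_eq]
        congr 1
        ring
      have hsum : ∑ c ∈ insert c₀ s,
          (f c * (κ * κ' * (lam c - lam c₀))) • (zmon Q Γ c * mon Q Γ a') ∈ P := by
        rw [← Finset.sum_congr rfl fun c _ => hterm c, Finset.sum_sub_distrib, ← Finset.smul_sum,
          ← Finset.smul_sum, ← Finset.mul_sum, ← Finset.sum_mul]
        exact P.sub_mem (smul_mem_ideal _ (P.mul_mem_left _ _ hf))
          (smul_mem_ideal _ (P.mul_mem_right _ _ hf))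
      rw [Finset.sum_insert hc₀, sub_self, mul_zero, mul_zero, zero_smul, zero_add] at hsum
      have := ih a' (ha.update_signed fun _ => hj ε) _ hsum c hc
      exact (mul_eq_zero.1 this).resolve_right
        (mul_ne_zero (mul_ne_zero h0 h0') (sub_ne_zero.2 (hsep ε)))
    intro c hc
    rcases Finset.mem_insert.1 hc with rfl | hc
    · rw [Finset.sum_insert hc₀, Finset.sum_eq_zero fun c hc => by rw [hs c hc, zero_smul],
        add_zero] at hf
      by_contra hne
      rw [smul_mem_ideal_iff hne] at hf
      exact zmon_mul_mon_notMem hΓ hQ hQ1 hP c.2 ha hf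
    · exact hs c hc

end

/-! ### Torus weights -/

theorem torusAction_G (t : Fin n → kˣ) (ε : Bool) (i : Fin n) :
    torusAction Q Γ t (G Q Γ ε i) = ((t i ^ signed ε 1 : kˣ) : k) • G Q Γ ε i := by
  cases ε
  · exact (torusHom_Y Q Γ t i).trans (by simp [signed, G])
  · exact (torusHom_X Q Γ t i).trans (by simp [signed, G])

theorem torusAction_Z (t : Fin n → kˣ) (m : ℕ) : torusAction Q Γ t (Z Q Γ m) = Z Q Γ m := by
  have hX := torusAction_G (Q := Q) (Γ := Γ) t true
  have hY := torusAction_G (Q := Q) (Γ := Γ) t false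
  simp only [G, signed] at hX hY
  simp only [Z, map_add, map_one, map_sum, map_smul, map_mul, hX, hY, smul_mul_smul_comm]
  simp

theorem torusAction_zmon (t : Fin n → kˣ) (c : Fin n → ℕ) :
    torusAction Q Γ t (zmon Q Γ c) = zmon Q Γ c := by
  rw [zmon, map_list_prod, List.map_map]
  congr 2
  ext i
  simp [torusAction_Z]

theorem torusAction_mon (t : Fin n → kˣ) (a : Fin n → ℤ) :
    torusAction Q Γ t (mon Q Γ a) = ((∏ i, t i ^ a i : kˣ) : k) • mon Q Γ a := by
  have h1 : ∀ i, torusAction Q Γ t (monFactor Q Γ a i) =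
      ((t i ^ a i : kˣ) : k) • monFactor Q Γ a i := by
    intro i
    obtain ⟨ε, m, hm⟩ := exists_eq_signed (a i)
    have h2 := monFactor_update_signed (Q := Q) (Γ := Γ) a i ε m
    rw [← hm, Function.update_eq_self] at h2
    rw [h2, map_pow, torusAction_G, smul_pow, ← Units.val_pow_eq_pow_val, ← zpow_natCast,
      ← zpow_mul, hm]
    congr 3
    cases ε <;> simp [signed]
  have key : ∀ l : List (Fin n), torusAction Q Γ t (l.map (monFactor Q Γ a)).prod =
      (((l.map fun i => t i ^ a i).prod : kˣ) : k) • (l.map (monFactor Q Γ a)).prod := by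
    intro l
    induction l with
    | nil => simp
    | cons i l ih =>
      simp only [List.map_cons, List.prod_cons, map_mul, ih, h1, smul_mul_smul_comm, Units.val_mul]
  rw [mon, key, ← List.ofFn_eq_map, List.prod_ofFn]

theorem mem_of_sum_mem (hQ : ∀ i, ∀ m : ℕ, 0 < m → Q i ^ m ≠ 1) {P : TwoSidedIdeal (QWeyl Q Γ)}
    (hH : ∀ t : Fin n → kˣ, ∀ a ∈ P, torusAction Q Γ t a ∈ P) {ι : Type*} {deg : ι → Fin n → ℤ}
    (hdeg : Function.Injective deg) {s : Finset ι} :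
    ∀ v : ι → QWeyl Q Γ,
    (∀ a ∈ s, ∀ t, torusAction Q Γ t (v a) = ((∏ i, t i ^ deg a i : kˣ) : k) • v a) →
    ∑ a ∈ s, v a ∈ P → ∀ a ∈ s, v a ∈ P := by
  classical
  induction s using Finset.induction with
  | empty => simp
  | insert a₀ s ha₀ ih =>
    intro v hv hsum
    have hs : ∀ a ∈ s, v a ∈ P := by
      intro a ha
      obtain ⟨i, hi⟩ := Function.ne_iff.1 (fun h : deg a = deg a₀ => ha₀ (hdeg h ▸ ha))
      -- As `q_i` has infinite order, this one torus element already separates the two degrees.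
      set t : Fin n → kˣ := Function.update 1 i (Q i) with ht
      have hχ : ∀ a : Fin n → ℤ, ∏ j, t j ^ a j = Q i ^ a i := by
        intro a
        rw [Finset.prod_eq_single i]
        · simp [ht]
        · intro j _ hj
          simp [ht, hj]
        · simp
      have h1 : ∑ a ∈ insert a₀ s,
          (((Q i ^ deg a i : kˣ) : k) - ((Q i ^ deg a₀ i : kˣ) : k)) • v a ∈ P := by
        have h2 := P.sub_mem (hH t _ hsum) (smul_mem_ideal ((Q i ^ deg a₀ i : kˣ) : k) hsum)
        rw [map_sum, Finset.smul_sum, ← Finset.sum_sub_distrib] at h2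
        rwa [Finset.sum_congr rfl fun a ha => by rw [hv a ha t, hχ, smul_sub_smul_eq]] at h2
      rw [Finset.sum_insert ha₀, sub_self, zero_smul, zero_add] at h1
      have h2 := ih _ (fun b hb t => by
        rw [map_smul, hv b (Finset.mem_insert_of_mem hb), smul_comm]) h1 a ha
      refine (smul_mem_ideal_iff (sub_ne_zero.2 fun h3 => hi ?_)).1 h2
      rw [Units.val_inj] at h3
      have h4 : ¬ IsOfFinOrder (Q i) := by
        rw [isOfFinOrder_iff_pow_eq_one]
        rintro ⟨m, hm, h3⟩
        exact hQ i m hm h3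
      exact injective_zpow_iff_not_isOfFinOrder.2 h4 h3
    intro a ha
    rcases Finset.mem_insert.1 ha with rfl | ha
    · rw [Finset.sum_insert ha₀] at hsum
      have := P.sub_mem hsum ((idealSubmodule P).sum_mem hs)
      rwa [add_sub_cancel_right] at this
    · exact hs a ha

/-- A torus-invariant prime ideal is generated by the elements indexed by its admissible set. -/
theorem le_of_contains (hΓ : ∀ i j, Γ i j * Γ j i = 1)
    (hQ : ∀ i, ∀ m : ℕ, 0 < m → Q i ^ m ≠ 1) (hQ1 : ∀ i : Fin n, (Q i : k) - 1 ≠ 0)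
    {P : TwoSidedIdeal (QWeyl Q Γ)} (hP : P.IsPrimeIdeal)
    (hH : ∀ t : Fin n → kˣ, ∀ a ∈ P, torusAction Q Γ t a ∈ P) {J : TwoSidedIdeal (QWeyl Q Γ)}
    (hJ : Contains J (toAdmissible hΓ hQ1 hP)) : P ≤ J := by
  classical
  intro p hp
  set T := toAdmissible hΓ hQ1 hP
  -- Spanning is used modulo `P ⊓ J`: the remainder lies in J, while the allowed part lies in P and
  -- vanishes by independence.
  have hT : Contains (P ⊓ J) T :=
    ⟨fun m hm => ⟨hm.2, hJ.z_mem m hm⟩,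
      fun i ε hi => ⟨(toAdmissible_g hΓ hQ1 hP ε i).1 hi, hJ.g_mem i ε hi⟩⟩
  obtain ⟨s, hs, r, hr, rfl⟩ := Submodule.mem_sup.1 (mem_span_allowedMon_sup hΓ hT hQ1 p)
  obtain ⟨f, rfl⟩ := (Finsupp.mem_span_range_iff_exists_finsupp).1 hs
  have hfP : (f.sum fun i a => a • allowedMon Q Γ T i) ∈ P := by
    have := P.sub_mem hp hr.1
    rwa [add_sub_cancel_right] at this
  suffices h : f = 0 by
    rw [h, Finsupp.sum_zero_index, zero_add]
    exact hr.2
  set s₁ := f.support.image Prod.fst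
  set s₂ := f.support.image Prod.snd
  have hsub : f.support ⊆ s₁ ×ˢ s₂ := Finset.subset_product
  have hsum : (f.sum fun i a => a • allowedMon Q Γ T i) =
      ∑ i ∈ s₁ ×ˢ s₂, f i • allowedMon Q Γ T i :=
    Finsupp.sum_of_support_subset f hsub _ fun i _ => zero_smul k (allowedMon Q Γ T i)
  rw [hsum, Finset.sum_product_right] at hfP
  have h1 := mem_of_sum_mem hQ hH (Subtype.val_injective (p := Allowed T)) (s := s₂)
    (fun a => ∑ c ∈ s₁, f (c, a) • allowedMon Q Γ T (c, a)) (fun a _ t => by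
      rw [map_sum, Finset.smul_sum]
      refine Finset.sum_congr rfl fun c _ => ?_
      rw [map_smul, allowedMon, map_mul, torusAction_zmon, torusAction_mon, mul_smul_comm,
        smul_comm]) hfP
  ext ⟨c, a⟩
  by_contra hne
  have hmem : (c, a) ∈ s₁ ×ˢ s₂ := hsub (Finsupp.mem_support_iff.2 hne)
  rw [Finset.mem_product] at hmem
  exact hne (coeff_eq_zero hΓ hQ hQ1 hP s₁ a a.2 (fun c => f (c, a)) (h1 a hmem.2) c hmem.1)

end QWeyl

/-! ### Quantum tori -/

namespace QuantumTorus

variable {k : Type*} [Field k] {I : Type*} [Fintype I] (M : I → I → kˣ)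

/-- The bicharacter with matrix `M`. -/
def bichar (v w : I → ℤ) : kˣ := ∏ p, ∏ r, M p r ^ (v p * w r)

theorem bichar_add_left (v v' w : I → ℤ) :
    bichar M (v + v') w = bichar M v w * bichar M v' w := by
  simp only [bichar, Pi.add_apply, add_mul, zpow_add, Finset.prod_mul_distrib]

theorem bichar_add_right (v w w' : I → ℤ) :
    bichar M v (w + w') = bichar M v w * bichar M v w' := by
  simp only [bichar, Pi.add_apply, mul_add, zpow_add, Finset.prod_mul_distrib]

@[simp] theorem bichar_zero_left (w : I → ℤ) : bichar M 0 w = 1 := by simp [bichar]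

@[simp] theorem bichar_zero_right (v : I → ℤ) : bichar M v 0 = 1 := by simp [bichar]

theorem bichar_neg_left (v w : I → ℤ) : bichar M (-v) w = (bichar M v w)⁻¹ := by
  rw [eq_inv_iff_mul_eq_one, ← bichar_add_left, neg_add_cancel, bichar_zero_left]

theorem bichar_neg_right (v w : I → ℤ) : bichar M v (-w) = (bichar M v w)⁻¹ := by
  rw [eq_inv_iff_mul_eq_one, ← bichar_add_right, neg_add_cancel, bichar_zero_right]

theorem bichar_single [DecidableEq I] (p r : I) :
    bichar M (Pi.single p 1) (Pi.single r 1) = M p r := by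
  rw [bichar, Finset.prod_eq_single p, Finset.prod_eq_single r]
  · simp
  · intro j _ hj
    simp [hj]
  · simp
  · intro j _ hj
    simp [hj]
  · simp

/-- The commutation factors of the quantum torus. -/
def commFactor (v w : I → ℤ) : kˣ := bichar M v w * (bichar M w v)⁻¹

theorem comm_add_left (v v' w : I → ℤ) : commFactor M (v + v') w = commFactor M v w * commFactor M v' w := by
  simp only [commFactor, bichar_add_left, bichar_add_right, mul_inv]
  exact mul_mul_mul_comm _ _ _ _

theorem comm_add_right (v w w' : I → ℤ) : commFactor M v (w + w') = commFactor M v w * commFactor M v w' := by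
  simp only [commFactor, bichar_add_left, bichar_add_right, mul_inv]
  exact mul_mul_mul_comm _ _ _ _

theorem comm_neg_left (v w : I → ℤ) : commFactor M (-v) w = (commFactor M v w)⁻¹ := by
  simp only [commFactor, bichar_neg_left, bichar_neg_right, mul_inv]

theorem comm_neg_right (v w : I → ℤ) : commFactor M v (-w) = (commFactor M v w)⁻¹ := by
  simp only [commFactor, bichar_neg_left, bichar_neg_right, mul_inv]

theorem comm_sub_left (v v' w : I → ℤ) : commFactor M (v - v') w = commFactor M v w * (commFactor M v' w)⁻¹ := by
  rw [sub_eq_add_neg, comm_add_left, comm_neg_left]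

theorem comm_sub_right (v w w' : I → ℤ) : commFactor M v (w - w') = commFactor M v w * (commFactor M v w')⁻¹ := by
  rw [sub_eq_add_neg, comm_add_right, comm_neg_right]

theorem comm_swap (v w : I → ℤ) : commFactor M w v = (commFactor M v w)⁻¹ := by
  simp [commFactor, mul_comm]

/-- The monomials of the quantum torus, as operators on its underlying vector space. -/
noncomputable def monomial (v : I → ℤ) : Module.End k ((I → ℤ) →₀ k) :=
  Finsupp.linearCombination k fun w => Finsupp.single (v + w) (bichar M v w : k)

theorem monomial_single (v w : I → ℤ) (c : k) :
    monomial M v (Finsupp.single w c) = Finsupp.single (v + w) (c * bichar M v w) := by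
  simp [monomial]

theorem monomial_mul (v w : I → ℤ) :
    monomial M v * monomial M w = (bichar M v w : k) • monomial M (v + w) := by
  refine Finsupp.lhom_ext fun u c => ?_
  rw [Module.End.mul_apply, monomial_single, monomial_single, LinearMap.smul_apply, monomial_single,
    Finsupp.smul_single, bichar_add_left, bichar_add_right, add_assoc]
  congr 1
  simp only [Units.val_mul, smul_eq_mul]
  ring

theorem monomial_zero : monomial M (0 : I → ℤ) = 1 := by
  refine Finsupp.lhom_ext fun u c => ?_
  rw [monomial_single]
  simp

theorem monomial_mul_comm (v w : I → ℤ) :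
    monomial M v * monomial M w = (commFactor M v w : k) • (monomial M w * monomial M v) := by
  rw [monomial_mul, monomial_mul, smul_smul, add_comm w v, ← Units.val_mul, commFactor,
    inv_mul_cancel_right]

theorem linearCombination_monomial_apply (f : (I → ℤ) →₀ k) :
    Finsupp.linearCombination k (monomial M) f (Finsupp.single 0 1) = f := by
  rw [Finsupp.linearCombination_apply, Finsupp.sum, LinearMap.sum_apply]
  simp only [LinearMap.smul_apply, monomial_single, add_zero, bichar_zero_right, Units.val_one,
    mul_one, Finsupp.smul_single, smul_eq_mul]
  exact Finsupp.sum_single f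

theorem monomial_injective : Function.Injective (monomial M) := by
  intro v w h
  have := congrArg (fun a => a (Finsupp.single 0 1)) h
  simp only [monomial_single, add_zero, bichar_zero_right, Units.val_one, mul_one] at this
  exact Finsupp.single_left_injective one_ne_zero this

theorem monomial_ne_zero (v : I → ℤ) : monomial M v ≠ 0 := by
  intro h
  have := congrArg (fun a => a (Finsupp.single 0 1)) h
  simp [monomial_single] at this

/-- The span of the monomials has no zero divisors. -/
theorem mul_ne_zero_of_mem_span {a b : Module.End k ((I → ℤ) →₀ k)}
    (ha : a ∈ Submodule.span k (Set.range (monomial M)))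
    (hb : b ∈ Submodule.span k (Set.range (monomial M))) (ha0 : a ≠ 0) (hb0 : b ≠ 0) :
    a * b ≠ 0 := by
  classical
  rw [← Finsupp.range_linearCombination] at ha hb
  obtain ⟨f, rfl⟩ := ha
  obtain ⟨g, rfl⟩ := hb
  have hf : f.support.Nonempty := by
    rw [Finsupp.support_nonempty_iff]
    rintro rfl
    simp at ha0
  have hg : g.support.Nonempty := by
    rw [Finsupp.support_nonempty_iff]
    rintro rfl
    simp at hb0
  -- Some exponent of the product comes from a single pair of exponents, so its coefficient cannot
  -- cancel.
  obtain ⟨v₀, hv₀, w₀, hw₀, huniq⟩ := UniqueSums.uniqueAdd_of_nonempty hf hg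
  intro h
  have h1 := congrArg (fun a => a (Finsupp.single 0 1) (v₀ + w₀)) h
  simp only [Module.End.mul_apply, linearCombination_monomial_apply, LinearMap.zero_apply,
    Finsupp.zero_apply] at h1
  have h2 : Finsupp.linearCombination k (monomial M) f g (v₀ + w₀) =
      ∑ v ∈ f.support, ∑ w ∈ g.support,
        f v * Finsupp.single (v + w) (g w * (bichar M v w : k)) (v₀ + w₀) := by
    conv_lhs => rw [← Finsupp.sum_single g]
    rw [Finsupp.linearCombination_apply, Finsupp.sum, LinearMap.sum_apply, Finsupp.finsetSum_apply]
    refine Finset.sum_congr rfl fun v _ => ?_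
    rw [Finsupp.sum, map_sum, Finsupp.finsetSum_apply]
    refine Finset.sum_congr rfl fun w _ => ?_
    rw [LinearMap.smul_apply, monomial_single, Finsupp.smul_apply, smul_eq_mul]
  rw [h2, Finset.sum_eq_single v₀, Finset.sum_eq_single w₀] at h1
  · rw [Finsupp.single_eq_same] at h1
    simp only [mul_eq_zero, Units.ne_zero, or_false] at h1
    exact h1.elim (Finsupp.mem_support_iff.1 hv₀) (Finsupp.mem_support_iff.1 hw₀)
  · intro w hw hne
    rw [Finsupp.single_eq_of_ne, mul_zero]
    intro he
    exact hne (huniq hv₀ hw he.symm).2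
  · exact fun h => absurd hw₀ h
  · intro v hv hne
    refine Finset.sum_eq_zero fun w hw => ?_
    rw [Finsupp.single_eq_of_ne, mul_zero]
    intro he
    exact hne (huniq hv hw he.symm).1
  · exact fun h => absurd hv₀ h

theorem mul_mem_span {a b : Module.End k ((I → ℤ) →₀ k)}
    (ha : a ∈ Submodule.span k (Set.range (monomial M)))
    (hb : b ∈ Submodule.span k (Set.range (monomial M))) :
    a * b ∈ Submodule.span k (Set.range (monomial M)) := by
  have h := Submodule.mul_mem_mul ha hb
  rw [Submodule.span_mul_span] at h
  refine Submodule.span_le.2 ?_ h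
  rintro _ ⟨_, ⟨v, rfl⟩, _, ⟨w, rfl⟩, rfl⟩
  change monomial M v * monomial M w ∈ _
  rw [monomial_mul]
  exact Submodule.smul_mem _ _ (Submodule.subset_span ⟨_, rfl⟩)

/-- Needed because the image of `y_i` may be a sum of two monomials; a common commutation factor on
all exponents is enough. -/
theorem mul_comm_of_mem_span {S S' : Set (I → ℤ)} {κ : k}
    (h : ∀ v ∈ S, ∀ w ∈ S', (commFactor M v w : k) = κ) {a b : Module.End k ((I → ℤ) →₀ k)}
    (ha : a ∈ Submodule.span k (monomial M '' S))
    (hb : b ∈ Submodule.span k (monomial M '' S')) : a * b = κ • (b * a) := by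
  induction ha using Submodule.span_induction with
  | zero => simp
  | add x y _ _ hx hy => rw [add_mul, mul_add, smul_add, hx, hy]
  | smul r x _ hx => rw [smul_mul_assoc, mul_smul_comm, hx, smul_comm]
  | mem x hx =>
    obtain ⟨v, hv, rfl⟩ := hx
    induction hb using Submodule.span_induction with
    | zero => simp
    | add x y _ _ hx hy => rw [add_mul, mul_add, smul_add, hx, hy]
    | smul r x _ hx => rw [smul_mul_assoc, mul_smul_comm, hx, smul_comm]
    | mem x hx =>
      obtain ⟨w, hw, rfl⟩ := hx
      rw [monomial_mul_comm, h v hv w hw]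

/-- The diagonal operator with eigenvalues given by a character. -/
noncomputable def diag (χ : Multiplicative (I → ℤ) →* kˣ) : Module.End k ((I → ℤ) →₀ k) :=
  Finsupp.linearCombination k fun w => Finsupp.single w (χ (Multiplicative.ofAdd w) : k)

omit [Fintype I] in
theorem diag_single (χ : Multiplicative (I → ℤ) →* kˣ) (w : I → ℤ) (c : k) :
    diag χ (Finsupp.single w c) = Finsupp.single w (c * χ (Multiplicative.ofAdd w)) := by
  simp [diag]

omit [Fintype I] in
theorem diag_mul_diag_inv (χ : Multiplicative (I → ℤ) →* kˣ) : diag χ * diag χ⁻¹ = 1 := by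
  refine Finsupp.lhom_ext fun u c => ?_
  rw [Module.End.mul_apply, diag_single, diag_single]
  simp

theorem diag_mul_of_mem_span {S : Set (I → ℤ)} {χ : Multiplicative (I → ℤ) →* kˣ} {κ : k}
    (h : ∀ v ∈ S, (χ (Multiplicative.ofAdd v) : k) = κ) {a : Module.End k ((I → ℤ) →₀ k)}
    (ha : a ∈ Submodule.span k (monomial M '' S)) : diag χ * a = κ • (a * diag χ) := by
  induction ha using Submodule.span_induction with
  | zero => simp
  | add x y _ _ hx hy => rw [add_mul, mul_add, smul_add, hx, hy]
  | smul r x _ hx => rw [smul_mul_assoc, mul_smul_comm, hx, smul_comm]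
  | mem x hx =>
    obtain ⟨v, hv, rfl⟩ := hx
    refine Finsupp.lhom_ext fun u c => ?_
    rw [Module.End.mul_apply, monomial_single, diag_single, LinearMap.smul_apply,
      Module.End.mul_apply, diag_single, monomial_single, Finsupp.smul_single, ofAdd_add, map_mul,
      Units.val_mul, h v hv, smul_eq_mul]
    congr 1
    ring

end QuantumTorus

namespace QWeyl

variable {k : Type*} [Field k] {n : ℕ} {Q : Fin n → kˣ} {Γ : Matrix (Fin n) (Fin n) k}

open QuantumTorus

/-! ### Representation in a quantum torus -/

/-- The matrix of the quantum torus in the variables `z_{j+1}` (`Sum.inl j`) and `u_i`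
(`Sum.inr i`). -/
def torusMatrix (Q : Fin n → kˣ) (g : Fin n → Fin n → kˣ) : Fin n ⊕ Fin n → Fin n ⊕ Fin n → kˣ
  | .inr i, .inl j => if i ≤ j then Q i else 1
  | .inr i, .inr j => if i < j then Q i * g i j else 1
  | .inl _, _ => 1

/-- The exponent of the variable `z_m`, with `z_0 = 1`. -/
def zExp (n m : ℕ) : Fin n ⊕ Fin n → ℤ
  | .inl j => if (j : ℕ) + 1 = m then 1 else 0
  | .inr _ => 0

/-- The exponent of the variable `u_i`. -/
def uExp (i : Fin n) : Fin n ⊕ Fin n → ℤ := Pi.single (Sum.inr i) 1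

theorem zExp_zero : zExp n 0 = 0 := by
  ext (j | j) <;> simp [zExp]

theorem zExp_succ (j : Fin n) : zExp n (j + 1) = Pi.single (Sum.inl j) 1 := by
  ext (l | l)
  · simp [zExp, Pi.single_apply, Fin.ext_iff]
  · simp [zExp]

section

variable (Q) (g : Fin n → Fin n → kˣ)

theorem comm_uExp_zExp (i : Fin n) {m : ℕ} (hm : m ≤ n) :
    commFactor (torusMatrix Q g) (uExp i) (zExp n m) = if (i : ℕ) < m then Q i else 1 := by
  cases m with
  | zero => simp [zExp_zero, commFactor]
  | succ m =>
    have h := zExp_succ (⟨m, hm⟩ : Fin n)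
    simp only at h
    rw [h, commFactor, uExp, bichar_single, bichar_single]
    simp [torusMatrix, Fin.le_def]

theorem comm_zExp_zExp {m m' : ℕ} (hm : m ≤ n) (hm' : m' ≤ n) :
    commFactor (torusMatrix Q g) (zExp n m) (zExp n m') = 1 := by
  cases m with
  | zero => simp [zExp_zero, commFactor]
  | succ m =>
    cases m' with
    | zero => simp [zExp_zero, commFactor]
    | succ m' =>
      have h := zExp_succ (⟨m, hm⟩ : Fin n)
      have h' := zExp_succ (⟨m', hm'⟩ : Fin n)
      simp only at h h'
      rw [h, h', commFactor, bichar_single, bichar_single]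
      simp [torusMatrix]

theorem comm_uExp_uExp {i j : Fin n} (h : i < j) :
    commFactor (torusMatrix Q g) (uExp i) (uExp j) = Q i * g i j := by
  rw [commFactor, uExp, uExp, bichar_single, bichar_single]
  simp [torusMatrix, h, h.not_gt]

end

variable (g : Fin n → Fin n → kˣ) (T : AdmissibleSet n)

open Classical in
/-- The image of `z_m`. -/
noncomputable def zetaOp (Q : Fin n → kˣ) (m : ℕ) : Module.End k ((Fin n ⊕ Fin n → ℤ) →₀ k) :=
  if T.z m then 0 else monomial (torusMatrix Q g) (zExp n m)

open Classical in
/-- The image of `x_i`. -/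
noncomputable def xOp (Q : Fin n → kˣ) (i : Fin n) : Module.End k ((Fin n ⊕ Fin n → ℤ) →₀ k) :=
  if T.x i then 0 else monomial (torusMatrix Q g) (uExp i)

open Classical in
/-- The image of `y_i`. -/
noncomputable def yOp (Q : Fin n → kˣ) (i : Fin n) : Module.End k ((Fin n ⊕ Fin n → ℤ) →₀ k) :=
  -- If `x_i` acts invertibly, `y_i` is solved for from `(q_i - 1) y_i x_i = z_{i+1} - z_i`. If
  -- `x_i` acts as 0, so do both `z`'s, and a monomial with the right commutation factors and torus
  -- weight suffices.
  if T.x i then (if T.y i then 0 else monomial (torusMatrix Q g) (zExp n (i + 1) - uExp i))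
  else ((Q i : k) - 1)⁻¹ • ((zetaOp g T Q (i + 1) + (-1 : k) • zetaOp g T Q i) *
    monomial (torusMatrix Q g) (-uExp i))

theorem xOp_mem (i : Fin n) :
    xOp g T Q i ∈ Submodule.span k (monomial (torusMatrix Q g) '' {uExp i}) := by
  unfold xOp
  split_ifs
  · exact Submodule.zero_mem _
  · exact Submodule.subset_span ⟨_, rfl, rfl⟩

/-- The variables `z_i` and `z_{i+1}` have the same commutation factor with `u_j` for `j ≠ i`, and
torus weight 0. For the relations with other indices and for the torus, `y_i` thus behaves like one
monomial. -/
theorem yOp_mem (i : Fin n) :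
    yOp g T Q i ∈ Submodule.span k (monomial (torusMatrix Q g) ''
      {v | ∃ m, (m = (i : ℕ) ∨ m = i + 1) ∧ v = zExp n m - uExp i}) := by
  have h : ∀ m, (m = (i : ℕ) ∨ m = i + 1) →
      zetaOp g T Q m * monomial (torusMatrix Q g) (-uExp i) ∈
      Submodule.span k (monomial (torusMatrix Q g) ''
        {v | ∃ m, (m = (i : ℕ) ∨ m = i + 1) ∧ v = zExp n m - uExp i}) := by
    intro m hm
    unfold zetaOp
    split_ifs
    · rw [zero_mul]
      exact Submodule.zero_mem _
    · rw [monomial_mul, ← sub_eq_add_neg]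
      exact Submodule.smul_mem _ _ (Submodule.subset_span ⟨_, ⟨m, hm, rfl⟩, rfl⟩)
  unfold yOp
  split_ifs
  · exact Submodule.zero_mem _
  · exact Submodule.subset_span ⟨_, ⟨_, Or.inr rfl, rfl⟩, rfl⟩
  · rw [add_mul, smul_mul_assoc]
    exact Submodule.smul_mem _ _ (Submodule.add_mem _ (h _ (Or.inr rfl))
      (Submodule.smul_mem _ _ (h _ (Or.inl rfl))))

theorem monomial_uExp_mul_neg (i : Fin n) :
    monomial (torusMatrix Q g) (uExp i) * monomial (torusMatrix Q g) (-uExp i) = 1 := by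
  rw [monomial_mul, add_neg_cancel, monomial_zero, bichar_neg_right, uExp, bichar_single]
  simp [torusMatrix]

theorem monomial_neg_mul_uExp (i : Fin n) :
    monomial (torusMatrix Q g) (-uExp i) * monomial (torusMatrix Q g) (uExp i) = 1 := by
  rw [monomial_mul, neg_add_cancel, monomial_zero, bichar_neg_left, uExp, bichar_single]
  simp [torusMatrix]

theorem monomial_uExp_mul_zetaOp (i : Fin n) {m : ℕ} (hm : m ≤ n) :
    monomial (torusMatrix Q g) (uExp i) * zetaOp g T Q m =
      (if (i : ℕ) < m then (Q i : k) else 1) •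
        (zetaOp g T Q m * monomial (torusMatrix Q g) (uExp i)) := by
  unfold zetaOp
  by_cases h : T.z m
  · simp [h]
  · rw [if_neg h, monomial_mul_comm, comm_uExp_zExp Q g i hm, apply_ite Units.val, Units.val_one]

theorem yOp_mul_xOp (hQ1 : ∀ i : Fin n, (Q i : k) - 1 ≠ 0) (i : Fin n) :
    ((Q i : k) - 1) • (yOp g T Q i * xOp g T Q i) = zetaOp g T Q (i + 1) + (-1 : k) • zetaOp g T Q i := by
  by_cases h : T.x i
  · have hz := T.z_of_x h
    simp [xOp, zetaOp, h, hz.1, hz.2]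
  · rw [yOp, if_neg h, xOp, if_neg h, smul_mul_assoc, smul_inv_smul₀ (hQ1 i), mul_assoc,
      monomial_neg_mul_uExp, mul_one]

/-- The variable `u_i` commutes with `z_i` and picks up `q_i` at `z_{i+1}`, so for `x_i` nonzero
`(q_i - 1) x_i y_i = q_i z_{i+1} - z_i`. -/
theorem xOp_mul_yOp (hQ1 : ∀ i : Fin n, (Q i : k) - 1 ≠ 0) (i : Fin n) :
    xOp g T Q i * yOp g T Q i = (Q i : k) • (yOp g T Q i * xOp g T Q i) + zetaOp g T Q i := by
  by_cases h : T.x i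
  · have hz := T.z_of_x h
    simp [xOp, zetaOp, h, hz.1]
  · have h1 := yOp_mul_xOp g T hQ1 i
    refine smul_right_injective _ (hQ1 i) ?_
    simp only [smul_add]
    rw [smul_comm, h1, yOp, if_neg h, xOp, if_neg h, mul_smul_comm, smul_inv_smul₀ (hQ1 i),
      ← mul_assoc, mul_add, mul_smul_comm, monomial_uExp_mul_zetaOp g T i i.2,
      monomial_uExp_mul_zetaOp g T i i.2.le, if_pos (Nat.lt_succ_self _), if_neg (lt_irrefl _),
      add_mul, smul_mul_assoc, smul_mul_assoc, smul_mul_assoc, mul_assoc, mul_assoc,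
      monomial_uExp_mul_neg]
    simp only [mul_one, one_smul]
    module

/-- By `yOp_mul_xOp` the sum telescopes, starting from `z_0 = 1`. -/
theorem one_add_sum_yOp_mul_xOp (hQ1 : ∀ i : Fin n, (Q i : k) - 1 ≠ 0) {m : ℕ} (hm : m ≤ n) :
    1 + ∑ l ∈ Finset.univ.filter fun l : Fin n => (l : ℕ) < m,
      ((Q l : k) - 1) • (yOp g T Q l * xOp g T Q l) = zetaOp g T Q m := by
  induction m with
  | zero => simp [zetaOp, T.not_z_zero, zExp_zero, monomial_zero]
  | succ m ih =>
    have h : (Finset.univ.filter fun l : Fin n => (l : ℕ) < m + 1) =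
        insert ⟨m, hm⟩ (Finset.univ.filter fun l : Fin n => (l : ℕ) < m) := by
      ext l
      simp only [Finset.mem_filter, Finset.mem_univ, true_and, Finset.mem_insert, Fin.ext_iff]
      omega
    rw [h, Finset.sum_insert (by simp), add_left_comm, ih (by omega),
      yOp_mul_xOp g T hQ1 ⟨m, hm⟩]
    module

/-- The images of the generators. -/
noncomputable def genOp (Q : Fin n → kˣ) : QWeylGen n → Module.End k ((Fin n ⊕ Fin n → ℤ) →₀ k)
  | .x i => xOp g T Q i
  | .y i => yOp g T Q i

theorem genOp_rel (hg : ∀ i j, (g i j : k) = Γ i j) (hdiag : ∀ i, Γ i i = 1)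
    (hΓ : ∀ i j, Γ i j * Γ j i = 1) (hQ1 : ∀ i : Fin n, (Q i : k) - 1 ≠ 0)
    ⦃a b : FreeAlgebra k (QWeylGen n)⦄ (h : QWeylRel Q Γ a b) :
    FreeAlgebra.lift k (genOp g T Q) a = FreeAlgebra.lift k (genOp g T Q) b := by
  have hgg : ∀ i j, g i j * g j i = 1 := fun i j => by
    rw [← Units.val_inj, Units.val_mul, hg, hg, hΓ, Units.val_one]
  have hginv : ∀ i j, (g i j)⁻¹ = g j i := fun i j => inv_eq_of_mul_eq_one_right (hgg i j)
  have hgt : ∀ {i j : Fin n}, j < i →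
      commFactor (torusMatrix Q g) (uExp i) (uExp j) = (Q j)⁻¹ * g i j := fun {i j} h => by
    rw [comm_swap, comm_uExp_uExp Q g h, mul_inv, hginv]
  cases h with
  | yy i j =>
    simp only [QWeylGen.freeY, map_mul, map_smul, FreeAlgebra.lift_ι_apply, genOp]
    rcases eq_or_ne i j with rfl | hij
    · rw [hdiag, one_smul]
    · refine mul_comm_of_mem_span _ ?_ (yOp_mem g T i) (yOp_mem g T j)
      rintro _ ⟨m, hm, rfl⟩ _ ⟨m', hm', rfl⟩
      rw [← hg, Units.val_inj, comm_sub_left, comm_sub_right, comm_sub_right,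
        comm_zExp_zExp Q g (by omega) (by omega), comm_uExp_zExp Q g i (by omega),
        comm_swap _ (uExp j), comm_uExp_zExp Q g j (by omega)]
      rcases lt_or_gt_of_ne hij with h | h
      · rw [comm_uExp_uExp Q g h, if_neg (by have : (i : ℕ) < j := h; omega),
          if_pos (by have : (i : ℕ) < j := h; omega)]
        simp
      · rw [hgt h, if_pos (by have : (j : ℕ) < i := h; omega),
          if_neg (by have : (j : ℕ) < i := h; omega)]
        simp
  | xy_lt i j h =>
    simp only [QWeylGen.freeX, QWeylGen.freeY, map_mul, map_smul, FreeAlgebra.lift_ι_apply, genOp]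
    refine mul_comm_of_mem_span _ ?_ (xOp_mem g T i) (yOp_mem g T j)
    rintro _ rfl _ ⟨m, hm, rfl⟩
    rw [← hg, Units.val_inj, comm_sub_right, comm_uExp_zExp Q g i (by omega),
      comm_uExp_uExp Q g h, if_pos (by have : (i : ℕ) < j := h; omega), mul_inv, hginv]
    simp
  | xy_gt i j h =>
    simp only [QWeylGen.freeX, QWeylGen.freeY, map_mul, map_smul, FreeAlgebra.lift_ι_apply, genOp]
    refine mul_comm_of_mem_span _ ?_ (xOp_mem g T i) (yOp_mem g T j)
    rintro _ rfl _ ⟨m, hm, rfl⟩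
    rw [← hg, ← Units.val_mul, Units.val_inj, comm_sub_right, comm_uExp_zExp Q g i (by omega),
      hgt h, if_neg (by have : (j : ℕ) < i := h; omega), mul_inv, hginv]
    simp
  | xx i j h =>
    simp only [QWeylGen.freeX, map_mul, map_smul, FreeAlgebra.lift_ι_apply, genOp]
    refine mul_comm_of_mem_span _ ?_ (xOp_mem g T i) (xOp_mem g T j)
    rintro _ rfl _ rfl
    rw [← hg, ← Units.val_mul, comm_uExp_uExp Q g h]
  | xy_eq i =>
    simp only [QWeylGen.freeX, QWeylGen.freeY, map_mul, map_smul, map_add, map_one, map_sum,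
      FreeAlgebra.lift_ι_apply, genOp]
    rw [xOp_mul_yOp g T hQ1, ← one_add_sum_yOp_mul_xOp g T hQ1 i.2.le, add_assoc]
    congr 3
    ext l
    simp

/-! ### The torus-stable prime of an admissible set -/

section

variable (hg : ∀ i j, (g i j : k) = Γ i j) (hdiag : ∀ i, Γ i i = 1)
    (hΓ : ∀ i j, Γ i j * Γ j i = 1) (hQ1 : ∀ i : Fin n, (Q i : k) - 1 ≠ 0)

/-- The representation attached to an admissible set. -/
noncomputable def rep : QWeyl Q Γ →ₐ[k] Module.End k ((Fin n ⊕ Fin n → ℤ) →₀ k) :=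
  RingQuot.liftAlgHom k ⟨FreeAlgebra.lift k (genOp g T Q), genOp_rel g T hg hdiag hΓ hQ1⟩

theorem rep_X (i : Fin n) : rep g T hg hdiag hΓ hQ1 (X Q Γ i) = xOp g T Q i := by
  simp [rep, X, QWeylGen.freeX, genOp]

theorem rep_Y (i : Fin n) : rep g T hg hdiag hΓ hQ1 (Y Q Γ i) = yOp g T Q i := by
  simp [rep, Y, QWeylGen.freeY, genOp]

theorem rep_Z {m : ℕ} (hm : m ≤ n) : rep g T hg hdiag hΓ hQ1 (Z Q Γ m) = zetaOp g T Q m := by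
  rw [← one_add_sum_yOp_mul_xOp g T hQ1 hm, Z]
  simp only [map_add, map_one, map_sum, map_smul, map_mul, rep_X, rep_Y]

theorem rep_mem (r : QWeyl Q Γ) : rep g T hg hdiag hΓ hQ1 r ∈
    Submodule.span k (Set.range (monomial (torusMatrix Q g))) := by
  have himage : ∀ S, Submodule.span k (monomial (torusMatrix Q g) '' S) ≤
      Submodule.span k (Set.range (monomial (torusMatrix Q g))) := fun S =>
    Submodule.span_mono (Set.image_subset_range _ _)
  induction r using induction_on with
  | smul_one r =>
    rw [map_smul, map_one, ← monomial_zero (torusMatrix Q g)]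
    exact Submodule.smul_mem _ _ (Submodule.subset_span ⟨_, rfl⟩)
  | gen ε i =>
    cases ε
    · exact himage _ ((rep_Y g T hg hdiag hΓ hQ1 i).symm ▸ yOp_mem g T i)
    · exact himage _ ((rep_X g T hg hdiag hΓ hQ1 i).symm ▸ xOp_mem g T i)
  | add a b ha hb =>
    rw [map_add]
    exact Submodule.add_mem _ ha hb
  | mul a b ha hb =>
    rw [map_mul]
    exact mul_mem_span _ ha hb

/-- The character of the torus grading attached to a torus element. -/
def gradingChar (t : Fin n → kˣ) : Multiplicative (Fin n ⊕ Fin n → ℤ) →* kˣ where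
  toFun v := ∏ i, t i ^ v.toAdd (Sum.inr i)
  map_one' := by simp
  map_mul' v w := by simp [zpow_add, Finset.prod_mul_distrib]

theorem gradingChar_zExp_sub (t : Fin n → kˣ) (m : ℕ) (i : Fin n) :
    gradingChar t (Multiplicative.ofAdd (zExp n m - uExp i)) = (t i)⁻¹ := by
  simp only [gradingChar, MonoidHom.coe_mk, OneHom.coe_mk, toAdd_ofAdd]
  rw [Finset.prod_eq_single i]
  · simp [zExp, uExp]
  · intro j _ hj
    simp [zExp, uExp, hj]
  · simp

theorem gradingChar_uExp (t : Fin n → kˣ) (i : Fin n) :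
    gradingChar t (Multiplicative.ofAdd (uExp i)) = t i := by
  simp only [gradingChar, MonoidHom.coe_mk, OneHom.coe_mk, toAdd_ofAdd]
  rw [Finset.prod_eq_single i]
  · simp [uExp]
  · intro j _ hj
    simp [uExp, hj]
  · simp

/-- The torus action is implemented by conjugation with invertible diagonal operators, so the kernel
is torus-stable. -/
theorem diag_mul_rep (t : Fin n → kˣ) (r : QWeyl Q Γ) :
    diag (gradingChar t) * rep g T hg hdiag hΓ hQ1 r =
      rep g T hg hdiag hΓ hQ1 (torusAction Q Γ t r) * diag (gradingChar t) := by
  induction r using induction_on with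
  | smul_one r => simp
  | gen ε i =>
    cases ε
    · have h1 : torusAction Q Γ t (Y Q Γ i) = _ := torusHom_Y Q Γ t i
      change _ * rep g T hg hdiag hΓ hQ1 (Y Q Γ i) =
        rep g T hg hdiag hΓ hQ1 (torusAction Q Γ t (Y Q Γ i)) * _
      rw [h1, map_smul, rep_Y, smul_mul_assoc]
      refine diag_mul_of_mem_span _ ?_ (yOp_mem g T i)
      rintro _ ⟨m, -, rfl⟩
      rw [gradingChar_zExp_sub]
    · have h1 : torusAction Q Γ t (X Q Γ i) = _ := torusHom_X Q Γ t i
      change _ * rep g T hg hdiag hΓ hQ1 (X Q Γ i) =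
        rep g T hg hdiag hΓ hQ1 (torusAction Q Γ t (X Q Γ i)) * _
      rw [h1, map_smul, rep_X, smul_mul_assoc]
      refine diag_mul_of_mem_span _ ?_ (xOp_mem g T i)
      rintro _ rfl
      rw [gradingChar_uExp]
  | add a b ha hb => simp only [map_add, mul_add, add_mul, ha, hb]
  | mul a b ha hb => rw [map_mul, map_mul, map_mul, ← mul_assoc, ha, mul_assoc, hb, mul_assoc]

/-- The kernel of the representation attached to an admissible set. -/
noncomputable def repKer : TwoSidedIdeal (QWeyl Q Γ) :=
  TwoSidedIdeal.ker (rep g T hg hdiag hΓ hQ1)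

theorem mem_repKer {r : QWeyl Q Γ} :
    r ∈ repKer g T hg hdiag hΓ hQ1 ↔ rep g T hg hdiag hΓ hQ1 r = 0 := TwoSidedIdeal.mem_ker _

/-- The image lies in the span of the monomials, which has no zero divisors, so the kernel is even
completely prime. -/
theorem isPrimeIdeal_repKer : (repKer g T hg hdiag hΓ hQ1).IsPrimeIdeal := by
  constructor
  · intro h
    have h1 : (1 : QWeyl Q Γ) ∈ repKer g T hg hdiag hΓ hQ1 := h ▸ trivial
    rw [mem_repKer, map_one, ← monomial_zero (torusMatrix Q g)] at h1
    exact monomial_ne_zero _ _ h1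
  · intro I J h
    by_contra hcon
    obtain ⟨hI, hJ⟩ := not_or.1 hcon
    obtain ⟨a, ha, ha'⟩ := Set.not_subset.1 hI
    obtain ⟨b, hb, hb'⟩ := Set.not_subset.1 hJ
    have h1 := h a ha b hb
    rw [mem_repKer, map_mul] at h1
    rw [SetLike.mem_coe, mem_repKer] at ha' hb'
    exact mul_ne_zero_of_mem_span _ (rep_mem g T hg hdiag hΓ hQ1 a)
      (rep_mem g T hg hdiag hΓ hQ1 b) ha' hb' h1

theorem torusAction_mem_repKer (t : Fin n → kˣ) {r : QWeyl Q Γ}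
    (hr : r ∈ repKer g T hg hdiag hΓ hQ1) :
    torusAction Q Γ t r ∈ repKer g T hg hdiag hΓ hQ1 := by
  rw [mem_repKer] at hr ⊢
  have h := diag_mul_rep g T hg hdiag hΓ hQ1 t r
  rw [hr, mul_zero] at h
  rw [← mul_one (rep g T hg hdiag hΓ hQ1 (torusAction Q Γ t r)),
    ← diag_mul_diag_inv (gradingChar t), ← mul_assoc, ← h, zero_mul]

theorem zetaOp_eq_zero_iff {m : ℕ} : zetaOp g T Q m = 0 ↔ T.z m := by
  by_cases h : T.z m <;> simp [zetaOp, h, monomial_ne_zero]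

theorem xOp_eq_zero_iff {i : Fin n} : xOp g T Q i = 0 ↔ T.x i := by
  by_cases h : T.x i <;> simp [xOp, h, monomial_ne_zero]

-- For `x_i` outside T, cancelling `u_i⁻¹` shows that `y_i` acts as 0 only if `z_i` and `z_{i+1}`
-- have equal images. Distinct monomials differ, so both images are 0, and admissibility then puts
-- `y_i` in T.
include hQ1 in
theorem yOp_eq_zero_iff {i : Fin n} : yOp g T Q i = 0 ↔ T.y i := by
  by_cases hx : T.x i
  · by_cases hy : T.y i <;> simp [yOp, hx, hy, monomial_ne_zero]
  rw [yOp, if_neg hx, smul_eq_zero, or_iff_right (inv_ne_zero (hQ1 i))]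
  constructor
  · intro h
    have h1 := congrArg (fun a => a * monomial (torusMatrix Q g) (uExp i)) h
    simp only [mul_assoc, monomial_neg_mul_uExp, mul_one, zero_mul] at h1
    replace h1 : zetaOp g T Q (i + 1) = zetaOp g T Q i := by
      calc zetaOp g T Q (i + 1)
          = (zetaOp g T Q (i + 1) + (-1 : k) • zetaOp g T Q i) + zetaOp g T Q i := by module
        _ = zetaOp g T Q i := by rw [h1, zero_add]
    have hz : T.z i ∧ T.z (i + 1) := by
      by_cases h2 : T.z i
      · refine ⟨h2, ?_⟩
        rwa [(zetaOp_eq_zero_iff g T).2 h2, zetaOp_eq_zero_iff] at h1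
      · have h3 : ¬ T.z (i + 1) := by
          intro h3
          rw [(zetaOp_eq_zero_iff g T).2 h3] at h1
          exact h2 ((zetaOp_eq_zero_iff g T).1 h1.symm)
        rw [zetaOp, zetaOp, if_neg h2, if_neg h3] at h1
        have := congrFun (monomial_injective _ h1) (Sum.inl i)
        simp [zExp] at this
    exact ((T.x_or_y_iff i).2 hz).resolve_left hx
  · intro h
    have hz := T.z_of_y h
    rw [(zetaOp_eq_zero_iff g T).2 hz.1, (zetaOp_eq_zero_iff g T).2 hz.2, smul_zero, add_zero,
      zero_mul]

theorem toAdmissible_repKer :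
    toAdmissible hΓ hQ1 (isPrimeIdeal_repKer g T hg hdiag hΓ hQ1) = T := by
  ext i
  · change i ≤ n ∧ _ ↔ _
    constructor
    · rintro ⟨hi, h⟩
      rwa [mem_repKer, rep_Z _ _ _ _ _ _ hi, zetaOp_eq_zero_iff] at h
    · intro h
      refine ⟨T.le_of_z i h, ?_⟩
      rwa [mem_repKer, rep_Z _ _ _ _ _ _ (T.le_of_z i h), zetaOp_eq_zero_iff]
  · change (∃ _ : i < n, _) ↔ _
    simp only [mem_repKer, rep_X, xOp_eq_zero_iff]
    exact ⟨fun ⟨_, h⟩ => h, fun h => ⟨T.lt_of_z_succ (T.z_of_x h).2, h⟩⟩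
  · change (∃ _ : i < n, _) ↔ _
    simp only [mem_repKer, rep_Y, yOp_eq_zero_iff g T hQ1]
    exact ⟨fun ⟨_, h⟩ => h, fun h => ⟨T.lt_of_z_succ (T.z_of_y h).2, h⟩⟩

end

/-- The torus-invariant prime spectrum is isomorphic to the poset of admissible sets. -/
theorem nonempty_orderIso_admissibleSet (hQ : ∀ i, ∀ m : ℕ, 0 < m → Q i ^ m ≠ 1)
    (hdiag : ∀ i, Γ i i = 1) (hΓ : ∀ i j, Γ i j * Γ j i = 1) :
    Nonempty (HSpec Q Γ ≃o AdmissibleSet n) := by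
  have hQ1 : ∀ i : Fin n, (Q i : k) - 1 ≠ 0 := fun i h => by
    refine hQ i 1 one_pos ?_
    rw [pow_one, ← Units.val_inj, Units.val_one]
    exact sub_eq_zero.1 h
  let f : HSpec Q Γ → AdmissibleSet n := fun P => toAdmissible hΓ hQ1 P.2.1
  have hf : ∀ P P', f P ≤ f P' ↔ P ≤ P' := by
    intro P P'
    constructor
    · intro h
      -- The inclusion of admissible sets says that `P'` contains the elements that generate P.
      refine le_of_contains hΓ hQ hQ1 P.2.1 P.2.2 ⟨fun m hm => (h.1 m hm).2, fun i ε hi => ?_⟩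
      rw [← toAdmissible_g hΓ hQ1 P'.2.1]
      cases ε
      · exact h.2.2 i hi
      · exact h.2.1 i hi
    · intro h
      exact ⟨fun m hm => ⟨hm.1, h hm.2⟩, fun i ⟨hi, hx⟩ => ⟨hi, h hx⟩,
        fun i ⟨hi, hy⟩ => ⟨hi, h hy⟩⟩
  refine ⟨RelIso.ofSurjective (OrderEmbedding.ofMapLEIff f hf) fun T => ?_⟩
  let g : Fin n → Fin n → kˣ := fun i j => ⟨Γ i j, Γ j i, hΓ i j, hΓ j i⟩
  exact ⟨⟨repKer g T (fun _ _ => rfl) hdiag hΓ hQ1, isPrimeIdeal_repKer g T _ hdiag hΓ hQ1,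
    fun t _ hr => torusAction_mem_repKer g T _ hdiag hΓ hQ1 t hr⟩,
    toAdmissible_repKer g T _ hdiag hΓ hQ1⟩

end QWeyl

theorem mainTheorem3 {k : Type*} [Field k] (n : ℕ) (hn : 1 ≤ n)
    (Q : Fin n → kˣ) (hQ : ∀ i, ∀ m : ℕ, 0 < m → Q i ^ m ≠ 1)
    (Γ : Matrix (Fin n) (Fin n) k)
    (hΓ_diag : ∀ i, Γ i i = 1) (hΓ : ∀ i j, Γ i j * Γ j i = 1)
    {W : Type*} [Group W] (cs : CoxeterSystem (CoxeterMatrix.A n) W) :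
    Nonempty (cs.BruhatInterval (cs.wordProd (palindromeWord n)) ≃o QWeyl.HSpec Q Γ) := by
  obtain ⟨e⟩ := AdmissibleSet.nonempty_orderIso_bruhatInterval cs
  obtain ⟨e'⟩ := QWeyl.nonempty_orderIso_admissibleSet hQ hΓ_diag hΓ
  exact ⟨e.symm.trans e'.symm⟩
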